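/- There is a universal constant $C > 0$ such that the following holds. Let $n$ be a non-negative integer (for $n=0$ the statement is trivial), let $M > 0$, and let $Q^n = [-M,M]^n \subset \mathbb{R}^n$. Let $f, g : Q^n \to [0,\infty)$ be unconditional, log-concave probability densities, regarded as functions on $\mathbb{R}^n$ that vanish outside $Q^n$. Here a function $\rho : \mathbb{R}^n \to [0,\infty)$ is unconditional if $\rho(x_1,\dots,x_n) = \rho(\pm x_1,\dots,\pm x_n)$ for all $x \in \mathbb{R}^n$ and all choices of signs, and it is log-concave if $\rho(\lambda x + (1-\lambda) y) \ge \rho(x)^{\lambda} \rho(y)^{1-\lambda}$ for all $x, y \in \mathbb{R}^n$ and $0 < \lambda < 1$. Let $\mu_f, \mu_g$ be the probability measures on $\mathbb{R}^n$ with densities $f, g$ with respect to Lebesgue measure, and put $$H(f,g)(x) = \sup_{y \in \mathbb{R}^n} \sqrt{f(x+y)\, g(x-y)} \qquad (x \in \mathbb{R}^n).$$ Then $H(f,g)$ is integrable on $Q^n$, $W_2(\mu_f,\mu_g)$ is finite, and $$W_2^2(\mu_f, \mu_g) \le C M^2 \left[ \int_{Q^n} H(f,g)(x)\, dx - 1 \right],$$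 where $W_2(\mu_1,\mu_2) = \inf_\gamma \left( \int_{\mathbb{R}^n \times \mathbb{R}^n} |x-y|^2 \, d\gamma(x,y) \right)^{1/2}$, the infimum running over all couplings $\gamma$ of $\mu_1$ and $\mu_2$ (Borel probability measures on $\mathbb{R}^n\times\mathbb{R}^n$ with marginals $\mu_1$ and $\mu_2$), and $|\cdot|$ is the Euclidean norm. -/

import Mathlib

open MeasureTheory Set
open scoped ENNReal

noncomputable section

/-- The cube `[-M, M]^n` in Euclidean space `ℝⁿ`. -/
def cube (n : ℕ) (M : ℝ) : Set (EuclideanSpace ℝ (Fin n)) :=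
  {x | ∀ i, x i ∈ Icc (-M) M}

/-- `ρ` is unconditional: it is invariant under all coordinate reflections,
`ρ (x₁, …, xₙ) = ρ (± x₁, …, ± xₙ)` for every choice of signs. -/
def IsUnconditional {n : ℕ} (ρ : EuclideanSpace ℝ (Fin n) → ℝ) : Prop :=
  ∀ ε : Fin n → ℝ, (∀ i, ε i = 1 ∨ ε i = -1) →
    ∀ x : EuclideanSpace ℝ (Fin n), ρ (WithLp.toLp 2 (fun i => ε i * x i)) = ρ x

/-- `ρ : ℝⁿ → [0, ∞)` is log-concave:
`ρ (l x + (1 - l) y) ≥ ρ(x)^l ρ(y)^(1 - l)` for all `x, y` and `0 < l < 1`. -/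
def IsLogConcave {n : ℕ} (ρ : EuclideanSpace ℝ (Fin n) → ℝ) : Prop :=
  (∀ x, 0 ≤ ρ x) ∧
  ∀ (x y : EuclideanSpace ℝ (Fin n)) (l : ℝ), 0 < l → l < 1 →
    ρ x ^ l * ρ y ^ (1 - l) ≤ ρ (l • x + (1 - l) • y)

/-- `f` is a probability density on `Q`, extended by zero outside `Q`.  Integrability of `f` is
part of the last clause, because the Bochner integral of a non-integrable function is `0`. -/
def IsProbDensityOn {n : ℕ} (Q : Set (EuclideanSpace ℝ (Fin n)))
    (f : EuclideanSpace ℝ (Fin n) → ℝ) : Prop :=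
  (∀ x, 0 ≤ f x) ∧ (∀ x, x ∉ Q → f x = 0) ∧ ∫ x, f x = 1

/-- The measure `μ_f` with density `f` with respect to Lebesgue measure. -/
def densityMeasure {n : ℕ} (f : EuclideanSpace ℝ (Fin n) → ℝ) :
    Measure (EuclideanSpace ℝ (Fin n)) :=
  volume.withDensity (fun x => ENNReal.ofReal (f x))

/-- `H(f,g)(x) = sup_y √(f(x+y) g(x-y))`.  For bounded `f` and `g` (in particular for unconditional
log-concave functions, which are maximal at the origin) the supremum is over a bounded set. -/
def supConv {n : ℕ} (f g : EuclideanSpace ℝ (Fin n) → ℝ) (x : EuclideanSpace ℝ (Fin n)) : ℝ :=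
  ⨆ y : EuclideanSpace ℝ (Fin n), Real.sqrt (f (x + y) * g (x - y))

/-- `γ` is a coupling of `μ` and `ν`. -/
def IsCoupling {n : ℕ} (μ ν : Measure (EuclideanSpace ℝ (Fin n)))
    (γ : Measure (EuclideanSpace ℝ (Fin n) × EuclideanSpace ℝ (Fin n))) : Prop :=
  γ.map Prod.fst = μ ∧ γ.map Prod.snd = ν

/-- The `L²` Monge–Kantorovich–Wasserstein distance, with values in `[0, ∞]`:
the infimum over all couplings `γ` of `(∫ |x - y|² dγ(x, y))^(1/2)`. -/
def W2 {n : ℕ} (μ ν : Measure (EuclideanSpace ℝ (Fin n))) : ℝ≥0∞ :=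
  ⨅ (γ : Measure (EuclideanSpace ℝ (Fin n) × EuclideanSpace ℝ (Fin n)))
    (_ : IsCoupling μ ν γ), (∫⁻ z, ‖z.1 - z.2‖ₑ ^ 2 ∂γ) ^ (1 / 2 : ℝ)

end

/-!
The Knothe map transports the uniform law on `(-1, 1)ⁿ` to a given density coordinate by
coordinate, each coordinate through the quantile function of a conditional marginal. Feeding the
same uniform point to the Knothe maps of `f` and `g` couples `μ_f` and `μ_g`, and the midpoints of
the coupled points give a lower bound for `∫ H(f, g)` by a change of variables in each coordinate,
as in the transport proof of the Prékopa–Leindler inequality. The excess `∫ H(f, g) - 1` turns out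
to dominate the cost of this coupling.

In dimension one, on the half-line, let `a` and `b` be the normalised densities at the quantiles
`x(u)` and `y(u)`. As `x' = 1 / a` and `y' = 1 / b`, the excess is at least the
integral of `(a + b) / (2 √(ab)) - 1`. A non-increasing density on `(0, M)` satisfies `1 - u ≤ M a`, and this
makes the excess at `u` at least `((1 - u) (x' - y'))² / (8 M²)` (`sqrt_mul_one_add_sq_le`). A
weighted Hardy inequality (`lintegral_sq_le_of_hardy`) then bounds `∫ (x - y)²`; the result is
`IsHalfDensity.transport_le`, with constant `32`. Evenness carries it to the line. The passage to
`ℝⁿ` is an induction on the dimension (`IsBoxDensity.transport_le`), in which the excesses of the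
successive coordinates add up because `(1 + p) (1 + q) ≥ 1 + p + q`.

Log-concavity and unconditionality serve only to show that the densities are non-increasing in the
absolute value of each coordinate (`IsLogConcave.anti`), a property that marginals and slices
inherit. Such functions need not be Borel measurable; they are replaced by their lower
semicontinuous regularisations `outerReg`, equal to them almost everywhere (`outerReg_ae_eq`).
-/

/-! ### Quantiles of non-increasing densities on the half-line -/

/-- The quantile function of the density `k` on `(0, ∞)`, normalised by its total mass: for a
finite mass `A`, `halfQuantile k u` is the point `x` for which `∫₀ˣ k = u A`. It is encoded as the
length of the set of points whose cumulative mass is still below `u A`; in this form joint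
measurability in `u` and in a parameter of `k` is immediate. -/
noncomputable def halfQuantile (k : ℝ → ℝ≥0∞) (u : ℝ) : ℝ :=
  (volume {t : ℝ | 0 < t ∧ ∫⁻ s in Ioc 0 t, k s < ENNReal.ofReal u * ∫⁻ s in Ioi 0, k s}).toReal

/-- The density `k` on the half-line `(0, ∞)` is non-increasing, vanishes beyond `M`, and has
positive finite mass. -/
structure IsHalfDensity (M : ℝ) (k : ℝ → ℝ≥0∞) : Prop where
  measurable : Measurable k
  antitoneOn : AntitoneOn k (Ioi 0)
  eq_zero : ∀ s, M < s → k s = 0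
  mass_ne_zero : ∫⁻ s in Ioi 0, k s ≠ 0
  mass_ne_top : ∫⁻ s in Ioi 0, k s ≠ ∞

namespace IsHalfDensity

variable {M : ℝ} {k : ℝ → ℝ≥0∞}

/-- The total mass of `k` on the half-line, as a real number. -/
noncomputable def mass (k : ℝ → ℝ≥0∞) : ℝ := (∫⁻ s in Ioi 0, k s).toReal

/-- The mass of `k` on `(0, t)`, as a real number. -/
noncomputable def cumul (k : ℝ → ℝ≥0∞) (t : ℝ) : ℝ := ∫ s in (0 : ℝ)..t, (k s).toReal

lemma mass_pos (hk : IsHalfDensity M k) : 0 < mass k :=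
  ENNReal.toReal_pos hk.mass_ne_zero hk.mass_ne_top

lemma ofReal_mass (hk : IsHalfDensity M k) : ENNReal.ofReal (mass k) = ∫⁻ s in Ioi 0, k s :=
  ENNReal.ofReal_toReal hk.mass_ne_top

lemma ne_top (hk : IsHalfDensity M k) {s : ℝ} (hs : 0 < s) : k s ≠ ∞ := by
  intro h
  apply hk.mass_ne_top
  rw [eq_top_iff]
  calc (∞ : ℝ≥0∞) = ∫⁻ _ in Ioc 0 s, ∞ := by
        simp [hs]
    _ ≤ ∫⁻ t in Ioc 0 s, k t := by
        refine setLIntegral_mono hk.measurable fun t ht => ?_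
        rw [← h]
        exact hk.antitoneOn ht.1 hs ht.2
    _ ≤ _ := lintegral_mono_set Ioc_subset_Ioi_self

lemma integrableOn (hk : IsHalfDensity M k) : IntegrableOn (fun s => (k s).toReal) (Ioi 0) :=
  integrable_toReal_of_lintegral_ne_top hk.measurable.aemeasurable hk.mass_ne_top

lemma intervalIntegrable (hk : IsHalfDensity M k) {a b : ℝ} (ha : 0 ≤ a) (hb : 0 ≤ b) :
    IntervalIntegrable (fun s => (k s).toReal) volume a b :=
  ⟨hk.integrableOn.mono_set fun _ h => ha.trans_lt h.1,
    hk.integrableOn.mono_set fun _ h => hb.trans_lt h.1⟩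

lemma lintegral_Ioc (hk : IsHalfDensity M k) {a b : ℝ} (ha : 0 ≤ a) (hab : a ≤ b) :
    ∫⁻ s in Ioc a b, k s = ENNReal.ofReal (∫ s in a..b, (k s).toReal) := by
  rw [intervalIntegral.integral_of_le hab, ofReal_integral_eq_lintegral_ofReal]
  · refine setLIntegral_congr_fun measurableSet_Ioc fun s hs => ?_
    exact (ENNReal.ofReal_toReal (hk.ne_top (ha.trans_lt hs.1))).symm
  · exact hk.integrableOn.mono_set fun _ h => ha.trans_lt h.1
  · exact ae_of_all _ fun _ => ENNReal.toReal_nonneg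

lemma cumul_sub (hk : IsHalfDensity M k) {a b : ℝ} (ha : 0 ≤ a) (hb : 0 ≤ b) :
    cumul k b - cumul k a = ∫ s in a..b, (k s).toReal :=
  intervalIntegral.integral_interval_sub_left (hk.intervalIntegrable le_rfl hb)
    (hk.intervalIntegrable le_rfl ha)

lemma toReal_antitone (hk : IsHalfDensity M k) {s t : ℝ} (hs : 0 < s) (hst : s ≤ t) :
    (k t).toReal ≤ (k s).toReal :=
  ENNReal.toReal_mono (hk.ne_top hs) (hk.antitoneOn hs (hs.trans_le hst) hst)

lemma le_cumul_sub (hk : IsHalfDensity M k) {a b : ℝ} (ha : 0 ≤ a) (hab : a ≤ b) :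
    (b - a) * (k b).toReal ≤ cumul k b - cumul k a := by
  rw [hk.cumul_sub ha (ha.trans hab)]
  have := intervalIntegral.integral_mono_on_of_le_Ioo (f := fun _ => (k b).toReal) hab
    intervalIntegrable_const (hk.intervalIntegrable ha (ha.trans hab))
    fun s hs => hk.toReal_antitone (ha.trans_lt hs.1) hs.2.le
  simpa using this

lemma cumul_sub_le (hk : IsHalfDensity M k) {a b : ℝ} (ha : 0 < a) (hab : a ≤ b) :
    cumul k b - cumul k a ≤ (b - a) * (k a).toReal := by
  rw [hk.cumul_sub ha.le (ha.le.trans hab)]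
  have := intervalIntegral.integral_mono_on_of_le_Ioo (g := fun _ => (k a).toReal) hab
    (hk.intervalIntegrable ha.le (ha.le.trans hab)) intervalIntegrable_const
    fun s hs => hk.toReal_antitone ha hs.1.le
  simpa using this

lemma cumul_mono (hk : IsHalfDensity M k) {a b : ℝ} (ha : 0 ≤ a) (hab : a ≤ b) :
    cumul k a ≤ cumul k b := by
  have := hk.le_cumul_sub ha hab
  have h2 : 0 ≤ (b - a) * (k b).toReal :=
    mul_nonneg (sub_nonneg.2 hab) ENNReal.toReal_nonneg
  linarith

lemma cumul_zero : cumul k 0 = 0 := by simp [cumul]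

lemma cumul_nonneg (hk : IsHalfDensity M k) {t : ℝ} (ht : 0 ≤ t) : 0 ≤ cumul k t := by
  simpa [cumul_zero] using hk.cumul_mono le_rfl ht

lemma cumul_eq_mass (hk : IsHalfDensity M k) {t : ℝ} (ht : 0 ≤ t) (hMt : M ≤ t) :
    cumul k t = mass k := by
  have h : ∫⁻ s in Ioi 0, k s = ∫⁻ s in Ioc 0 t, k s := by
    rw [← Ioc_union_Ioi_eq_Ioi ht, lintegral_union measurableSet_Ioi
      (Set.disjoint_left.2 fun x hx hx' => not_lt.2 hx.2 hx')]
    have : ∫⁻ s in Ioi t, k s = 0 := by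
      rw [setLIntegral_congr_fun (g := fun _ => 0) measurableSet_Ioi
        fun s hs => hk.eq_zero s (hMt.trans_lt hs)]
      simp
    simp [this]
  rw [mass, h, hk.lintegral_Ioc le_rfl ht, ENNReal.toReal_ofReal]
  · rfl
  · exact hk.cumul_nonneg ht

lemma M_pos (hk : IsHalfDensity M k) : 0 < M := by
  by_contra h
  have := hk.cumul_eq_mass le_rfl (not_lt.1 h)
  rw [cumul_zero] at this
  exact hk.mass_pos.ne this

lemma pos_of_cumul_lt (hk : IsHalfDensity M k) {t : ℝ} (ht : 0 < t) (h : cumul k t < mass k) :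
    0 < (k t).toReal := by
  by_contra h0
  have h1 := hk.cumul_sub_le ht (le_max_left t M)
  rw [hk.cumul_eq_mass (ht.le.trans (le_max_left _ _)) (le_max_right _ _)] at h1
  have h2 : (k t).toReal = 0 := le_antisymm (not_lt.1 h0) ENNReal.toReal_nonneg
  rw [h2, mul_zero] at h1
  linarith

lemma cumul_lt (hk : IsHalfDensity M k) {a b : ℝ} (ha : 0 ≤ a) (hab : a < b)
    (h : cumul k a < mass k) : cumul k a < cumul k b := by
  rcases lt_or_ge (cumul k b) (mass k) with hb | hb
  · have h1 := hk.le_cumul_sub ha hab.le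
    have h2 := mul_pos (sub_pos.2 hab) (hk.pos_of_cumul_lt (ha.trans_lt hab) hb)
    linarith
  · exact h.trans_le hb

lemma halfQuantile_eq (hk : IsHalfDensity M k) {x u : ℝ} (hx : 0 ≤ x) (hu : u < 1)
    (h : cumul k x = u * mass k) : halfQuantile k u = x := by
  have hlt : cumul k x < mass k := by
    rw [h]; exact mul_lt_of_lt_one_left hk.mass_pos hu
  have hu0 : 0 ≤ u := by
    have := hk.cumul_nonneg hx
    rw [h] at this
    exact nonneg_of_mul_nonneg_left this hk.mass_pos
  have : {t : ℝ | 0 < t ∧ ∫⁻ s in Ioc 0 t, k s < ENNReal.ofReal u * ∫⁻ s in Ioi 0, k s}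
      = Ioo 0 x := by
    ext t
    simp only [mem_ofPred_eq, mem_Ioo]
    refine and_congr_right fun ht => ?_
    rw [hk.lintegral_Ioc le_rfl ht.le, ← hk.ofReal_mass, ← ENNReal.ofReal_mul hu0, ← h]
    change ENNReal.ofReal (cumul k t) < _ ↔ _
    rw [ENNReal.ofReal_lt_ofReal_iff_of_nonneg (hk.cumul_nonneg ht.le)]
    refine ⟨fun hc => ?_, fun htx => ?_⟩
    · by_contra hxt
      exact not_lt.2 (hk.cumul_mono hx (not_lt.1 hxt)) hc
    · exact hk.cumul_lt ht.le htx ((hk.cumul_mono ht.le htx.le).trans_lt hlt)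
  rw [halfQuantile, this, Real.volume_Ioo, sub_zero, ENNReal.toReal_ofReal hx]

lemma continuousOn_cumul (hk : IsHalfDensity M k) {t : ℝ} (ht : 0 ≤ t) :
    ContinuousOn (cumul k) (Icc 0 t) := by
  have := intervalIntegral.continuousOn_primitive_interval (a := 0) (b := t)
    (f := fun s => (k s).toReal) (μ := volume) ?_
  · rwa [uIcc_of_le ht] at this
  · rw [uIcc_of_le ht, integrableOn_Icc_iff_integrableOn_Ioc]
    exact hk.integrableOn.mono_set Ioc_subset_Ioi_self

lemma exists_cumul_eq (hk : IsHalfDensity M k) {u : ℝ} (hu : u ∈ Ico (0 : ℝ) 1) :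
    ∃ x, 0 ≤ x ∧ x ≤ M ∧ cumul k x = u * mass k := by
  have hM := hk.M_pos.le
  obtain ⟨x, hx, h⟩ := intermediate_value_Icc hM (hk.continuousOn_cumul hM)
    (show u * mass k ∈ _ by
      rw [cumul_zero, hk.cumul_eq_mass hM le_rfl]
      exact ⟨mul_nonneg hu.1 hk.mass_pos.le, mul_le_of_le_one_left hk.mass_pos.le hu.2.le⟩)
  exact ⟨x, hx.1, hx.2, h⟩

lemma halfQuantile_spec (hk : IsHalfDensity M k) {u : ℝ} (hu : u ∈ Ico (0 : ℝ) 1) :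
    0 ≤ halfQuantile k u ∧ halfQuantile k u ≤ M ∧ cumul k (halfQuantile k u) = u * mass k := by
  obtain ⟨x, hx, hxM, h⟩ := hk.exists_cumul_eq hu
  rw [hk.halfQuantile_eq hx hu.2 h]
  exact ⟨hx, hxM, h⟩

lemma halfQuantile_zero (hk : IsHalfDensity M k) : halfQuantile k 0 = 0 :=
  hk.halfQuantile_eq le_rfl one_pos (by simp [cumul_zero])

lemma halfQuantile_lt (hk : IsHalfDensity M k) {u v : ℝ} (hu : u ∈ Ico (0 : ℝ) 1)
    (hv : v ∈ Ico (0 : ℝ) 1) (huv : u < v) : halfQuantile k u < halfQuantile k v := by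
  by_contra h
  have h1 := hk.cumul_mono (hk.halfQuantile_spec hv).1 (not_lt.1 h)
  rw [(hk.halfQuantile_spec hv).2.2, (hk.halfQuantile_spec hu).2.2] at h1
  exact not_lt.2 h1 (mul_lt_mul_of_pos_right huv hk.mass_pos)

lemma halfQuantile_pos (hk : IsHalfDensity M k) {u : ℝ} (hu : u ∈ Ioo (0 : ℝ) 1) :
    0 < halfQuantile k u := by
  simpa [hk.halfQuantile_zero] using
    hk.halfQuantile_lt (u := 0) (by simp) ⟨hu.1.le, hu.2⟩ hu.1

lemma cumul_halfQuantile_lt (hk : IsHalfDensity M k) {u : ℝ} (hu : u ∈ Ico (0 : ℝ) 1) :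
    cumul k (halfQuantile k u) < mass k := by
  rw [(hk.halfQuantile_spec hu).2.2]
  exact mul_lt_of_lt_one_left hk.mass_pos hu.2

lemma density_halfQuantile_pos (hk : IsHalfDensity M k) {u : ℝ} (hu : u ∈ Ioo (0 : ℝ) 1) :
    0 < (k (halfQuantile k u)).toReal :=
  hk.pos_of_cumul_lt (hk.halfQuantile_pos hu) (hk.cumul_halfQuantile_lt ⟨hu.1.le, hu.2⟩)

/-- The mass beyond the quantile is at most the length `M` times the density there. -/
lemma one_sub_mul_mass_le (hk : IsHalfDensity M k) {u : ℝ} (hu : u ∈ Ioo (0 : ℝ) 1) :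
    (1 - u) * mass k ≤ M * (k (halfQuantile k u)).toReal := by
  obtain ⟨h0, hM, h⟩ := hk.halfQuantile_spec ⟨hu.1.le, hu.2⟩
  have h1 := hk.cumul_sub_le (hk.halfQuantile_pos hu) hM
  rw [hk.cumul_eq_mass hk.M_pos.le le_rfl, h] at h1
  have h2 : (M - halfQuantile k u) * (k (halfQuantile k u)).toReal
      ≤ M * (k (halfQuantile k u)).toReal := by
    gcongr; linarith
  linarith

lemma halfQuantile_sub_le (hk : IsHalfDensity M k) {u v : ℝ} (hu : 0 ≤ u) (huv : u ≤ v)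
    (hv : v < 1) : (1 - v) * (halfQuantile k v - halfQuantile k u) ≤ M * (v - u) := by
  rcases huv.eq_or_lt with rfl | huv
  · simp
  have hv' : v ∈ Ioo (0 : ℝ) 1 := ⟨hu.trans_lt huv, hv⟩
  have hu' : u ∈ Ico (0 : ℝ) 1 := ⟨hu, huv.trans hv⟩
  have hvI : v ∈ Ico (0 : ℝ) 1 := ⟨hv'.1.le, hv⟩
  have h1 := hk.one_sub_mul_mass_le hv'
  have hlt := hk.halfQuantile_lt hu' hvI huv
  have h2 := hk.le_cumul_sub (hk.halfQuantile_spec hu').1 hlt.le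
  rw [(hk.halfQuantile_spec hvI).2.2, (hk.halfQuantile_spec hu').2.2] at h2
  have hA := hk.mass_pos
  have h3 := mul_le_mul_of_nonneg_left h1 (sub_pos.2 hlt).le
  have h4 := mul_le_mul_of_nonneg_left h2 hk.M_pos.le
  refine le_of_mul_le_mul_right ?_ hA
  linarith

lemma continuousOn_halfQuantile (hk : IsHalfDensity M k) :
    ContinuousOn (halfQuantile k) (Ico 0 1) := by
  intro w hw
  obtain ⟨v, hwv, hv⟩ := exists_between hw.2
  have hlip : LipschitzOnWith (M / (1 - v)).toNNReal (halfQuantile k) (Icc 0 v) := by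
    have hc : 0 ≤ M / (1 - v) := div_nonneg hk.M_pos.le (by linarith)
    refine LipschitzOnWith.of_le_add_mul _ fun x hx y hy => ?_
    rw [Real.coe_toNNReal _ hc]
    rcases le_total x y with h | h
    · have : halfQuantile k x ≤ halfQuantile k y := by
        rcases h.eq_or_lt with rfl | h
        · rfl
        · exact (hk.halfQuantile_lt ⟨hx.1, hx.2.trans_lt hv⟩ ⟨hy.1, hy.2.trans_lt hv⟩ h).le
      have : 0 ≤ M / (1 - v) * dist x y := mul_nonneg hc dist_nonneg
      linarith
    · have h1 := hk.halfQuantile_sub_le hy.1 h (hx.2.trans_lt hv)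
      rw [Real.dist_eq, abs_of_nonneg (sub_nonneg.2 h), div_mul_eq_mul_div,
        ← sub_le_iff_le_add', le_div_iff₀ (by linarith)]
      have hmono : halfQuantile k y ≤ halfQuantile k x := by
        rcases h.eq_or_lt with rfl | h
        · rfl
        · exact (hk.halfQuantile_lt ⟨hy.1, hy.2.trans_lt hv⟩ ⟨hx.1, hx.2.trans_lt hv⟩ h).le
      have h2 : (halfQuantile k x - halfQuantile k y) * (1 - v)
          ≤ (halfQuantile k x - halfQuantile k y) * (1 - x) := by
        gcongr
        exact hx.2
      linarith
  refine (hlip.continuousOn w ⟨hw.1, hwv.le⟩).mono_of_mem_nhdsWithin ?_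
  refine mem_nhdsWithin.2 ⟨Iio v, isOpen_Iio, hwv, fun x hx => ⟨hx.2.1, hx.1.le⟩⟩

/-- The set of `u` for which the density jumps at the quantile of `u`. -/
def jumps (k : ℝ → ℝ≥0∞) : Set ℝ :=
  {u | u ∈ Ioo (0 : ℝ) 1 ∧ ¬ ContinuousAt k (halfQuantile k u)}

lemma countable_jumps (hk : IsHalfDensity M k) : (jumps k).Countable := by
  refine countable_of_injective_of_countable_image (f := halfQuantile k) ?_ ?_
  · have : StrictMonoOn (halfQuantile k) (jumps k) := fun u hu v hv huv =>
      hk.halfQuantile_lt ⟨hu.1.1.le, hu.1.2⟩ ⟨hv.1.1.le, hv.1.2⟩ huv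
    exact this.injOn
  · refine hk.antitoneOn.countable_not_continuousWithinAt.mono ?_
    rintro _ ⟨u, hu, rfl⟩
    have hpos := hk.halfQuantile_pos hu.1
    exact ⟨hpos, fun h => hu.2 (h.continuousAt (Ioi_mem_nhds hpos))⟩

lemma hasDerivAt_halfQuantile (hk : IsHalfDensity M k) {u : ℝ} (hu : u ∈ Ioo (0 : ℝ) 1)
    (hj : u ∉ jumps k) :
    HasDerivAt (halfQuantile k) (mass k / (k (halfQuantile k u)).toReal) u := by
  have hpos := hk.halfQuantile_pos hu
  have hcont : ContinuousAt k (halfQuantile k u) := by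
    by_contra h; exact hj ⟨hu, h⟩
  have hc : ContinuousAt (fun s => (k s).toReal) (halfQuantile k u) :=
    (ENNReal.tendsto_toReal (hk.ne_top hpos)).comp hcont
  have hder : HasDerivAt (cumul k) (k (halfQuantile k u)).toReal (halfQuantile k u) :=
    intervalIntegral.integral_hasDerivAt_right (hk.intervalIntegrable le_rfl hpos.le)
      (hk.measurable.ennreal_toReal.stronglyMeasurable.stronglyMeasurableAtFilter) hc
  have hq : ContinuousAt (halfQuantile k) u :=
    hk.continuousOn_halfQuantile.continuousAt (Ico_mem_nhds hu.1 hu.2)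
  have := HasDerivAt.of_local_left_inverse hq (hder.div_const (mass k))
    (div_pos (hk.density_halfQuantile_pos hu) hk.mass_pos).ne' ?_
  · rwa [inv_div] at this
  · filter_upwards [Ico_mem_nhds hu.1 hu.2] with v hv
    rw [(hk.halfQuantile_spec hv).2.2, mul_div_cancel_right₀ _ hk.mass_pos.ne']

/-- The quantile function pushes the uniform law on `(0, 1)` to the normalised density. -/
lemma lintegral_mul_eq (hk : IsHalfDensity M k) (ψ : ℝ → ℝ≥0∞) :
    ∫⁻ s in Ioi 0, ψ s * k s
      = (∫⁻ s in Ioi 0, k s) * ∫⁻ u in Ioo 0 1, ψ (halfQuantile k u) := by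
  set S : Set ℝ := Ioo 0 1 \ jumps k with hS
  have hSm : MeasurableSet S := measurableSet_Ioo.diff hk.countable_jumps.measurableSet
  have hinj : InjOn (halfQuantile k) (Ioo 0 1) :=
    StrictMonoOn.injOn fun u hu v hv huv =>
      hk.halfQuantile_lt ⟨hu.1.le, hu.2⟩ ⟨hv.1.le, hv.2⟩ huv
  have hcv := lintegral_image_eq_lintegral_abs_deriv_mul hSm
    (fun u hu => (hk.hasDerivAt_halfQuantile hu.1 hu.2).hasDerivWithinAt)
    (hinj.mono sdiff_subset) (fun s => ψ s * k s)
  have hSae : S =ᵐ[volume] (Ioo 0 1 : Set ℝ) :=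
    sdiff_null_ae_eq_self (hk.countable_jumps.measure_zero _)
  have hTm : MeasurableSet (halfQuantile k '' S) :=
    hSm.image_of_continuousOn_injOn
      (hk.continuousOn_halfQuantile.mono fun u hu => ⟨hu.1.1.le, hu.1.2⟩)
      (hinj.mono sdiff_subset)
  have htop : {s : ℝ | 0 < s ∧ k s ≠ 0 ∧ mass k ≤ cumul k s}.Subsingleton := by
    have key : ∀ s t : ℝ, 0 < s → mass k ≤ cumul k s → k t ≠ 0 → ¬ s < t := by
      intro s t hs hms hkt hst
      have h1 := hk.le_cumul_sub hs.le hst.le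
      have h2 := hk.cumul_mono (hs.trans hst).le (le_max_left t M)
      rw [hk.cumul_eq_mass ((hs.trans hst).le.trans (le_max_left _ _)) (le_max_right _ _)] at h2
      have h3 : 0 < (k t).toReal := ENNReal.toReal_pos hkt (hk.ne_top (hs.trans hst))
      have h4 := mul_pos (sub_pos.2 hst) h3
      linarith
    intro s hs t ht
    exact le_antisymm (not_lt.1 (key t s ht.1 ht.2.2 hs.2.1))
      (not_lt.1 (key s t hs.1 hs.2.2 ht.2.1))
  have hae : (Ioi 0).indicator (fun s => ψ s * k s)
      =ᵐ[volume] (halfQuantile k '' S).indicator (fun s => ψ s * k s) := by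
    filter_upwards [htop.countable.ae_notMem volume,
      (hk.countable_jumps.image (halfQuantile k)).ae_notMem volume] with s h1 h2
    by_cases hs : s ∈ halfQuantile k '' S
    · rw [indicator_of_mem hs]
      obtain ⟨u, hu, rfl⟩ := hs
      exact indicator_of_mem (hk.halfQuantile_pos hu.1) _
    rw [indicator_of_notMem hs, indicator_apply_eq_zero]
    intro hs0
    by_cases hks : k s = 0
    · simp [hks]
    have hlt : cumul k s < mass k := by
      by_contra h
      exact h1 ⟨hs0, hks, not_lt.1 h⟩
    have hu0 : 0 < cumul k s := by
      have := hk.cumul_lt le_rfl hs0 (by rw [cumul_zero]; exact hk.mass_pos)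
      rwa [cumul_zero] at this
    have hu : cumul k s / mass k ∈ Ioo (0 : ℝ) 1 :=
      ⟨div_pos hu0 hk.mass_pos, (div_lt_one hk.mass_pos).2 hlt⟩
    have hq : halfQuantile k (cumul k s / mass k) = s :=
      hk.halfQuantile_eq (le_of_lt hs0) hu.2 (div_mul_cancel₀ _ hk.mass_pos.ne').symm
    by_cases hj : cumul k s / mass k ∈ jumps k
    · exact absurd ⟨_, hj, hq⟩ h2
    · exact absurd ⟨_, ⟨hu, hj⟩, hq⟩ hs
  rw [← lintegral_indicator measurableSet_Ioi, lintegral_congr_ae hae, lintegral_indicator hTm,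
    hcv, ← lintegral_const_mul' _ _ hk.mass_ne_top, ← setLIntegral_congr hSae]
  refine setLIntegral_congr_fun hSm fun u hu => ?_
  have hpos := hk.density_halfQuantile_pos hu.1
  have hkq := ENNReal.ofReal_toReal (hk.ne_top (hk.halfQuantile_pos hu.1))
  rw [abs_of_pos (div_pos hk.mass_pos hpos), ← hk.ofReal_mass, mul_left_comm]
  nth_rw 2 [← hkq]
  rw [← ENNReal.ofReal_mul (div_pos hk.mass_pos hpos).le, div_mul_cancel₀ _ hpos.ne', mul_comm]

end IsHalfDensity

/-! ### The transport inequality on the half-line -/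

/-- A weighted Hardy inequality on `(0, 1)`. It is obtained by integrating the derivative of
`(1 - u) D²`, which is at most `-D² / 2 + 2 ((1 - u) D')²`. -/
lemma lintegral_sq_le_of_hardy {D : ℝ → ℝ} {J : Set ℝ} (hJ : J.Countable)
    (hc : ContinuousOn D (Ico 0 1)) (h0 : D 0 = 0)
    (hd : ∀ u ∈ Ioo (0 : ℝ) 1 \ J, DifferentiableAt ℝ D u) :
    ∫⁻ u in Ioo 0 1, ENNReal.ofReal (D u ^ 2)
      ≤ 4 * ∫⁻ u in Ioo 0 1, ENNReal.ofReal (((1 - u) * deriv D u) ^ 2) := by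
  by_cases htop : ∫⁻ u in Ioo 0 1, ENNReal.ofReal (((1 - u) * deriv D u) ^ 2) = ∞
  · rw [htop]; simp
  have hem : Measurable fun u => (1 - u) * deriv D u :=
    (measurable_const.sub measurable_id).mul (measurable_deriv D)
  have he2 : IntegrableOn (fun u => ((1 - u) * deriv D u) ^ 2) (Ioo 0 1) := by
    refine ⟨(hem.pow_const 2).aestronglyMeasurable, ?_⟩
    rw [hasFiniteIntegral_iff_ofReal (ae_of_all _ fun _ => sq_nonneg _)]
    exact lt_top_iff_ne_top.2 htop
  have he : IntegrableOn (fun u => (1 - u) * deriv D u) (Ioo 0 1) := by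
    refine Integrable.mono' ((integrableOn_const (C := (1 : ℝ)) (by simp)).add he2)
      hem.aestronglyMeasurable (ae_of_all _ fun u => ?_)
    rw [Real.norm_eq_abs, Pi.add_apply, ← sq_abs ((1 - u) * deriv D u)]
    nlinarith [sq_nonneg (|(1 - u) * deriv D u| - 1), abs_nonneg ((1 - u) * deriv D u)]
  -- It suffices to bound the integral over `(0, b]` for every `b < 1`.
  have key : ∀ b ∈ Ioo (0 : ℝ) 1, ∫⁻ u in Ioc 0 b, ENNReal.ofReal (D u ^ 2)
      ≤ 4 * ∫⁻ u in Ioo 0 1, ENNReal.ofReal (((1 - u) * deriv D u) ^ 2) := by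
    intro b hb
    have hsub : Ioc 0 b ⊆ Ioo (0 : ℝ) 1 := fun u hu => ⟨hu.1, hu.2.trans_lt hb.2⟩
    have hcb : ContinuousOn D (Icc 0 b) := hc.mono fun u hu => ⟨hu.1, hu.2.trans_lt hb.2⟩
    have hcu : ContinuousOn D (uIcc 0 b) := by rwa [uIcc_of_le hb.1.le]
    have i1 : IntervalIntegrable (fun u => D u ^ 2) volume 0 b := (hcu.pow 2).intervalIntegrable
    have i2 : IntervalIntegrable (fun u => ((1 - u) * deriv D u) ^ 2) volume 0 b :=
      (intervalIntegrable_iff_integrableOn_Ioc_of_le hb.1.le).2 (he2.mono_set hsub)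
    have i3 : IntervalIntegrable (fun u => (1 - u) * deriv D u) volume 0 b :=
      (intervalIntegrable_iff_integrableOn_Ioc_of_le hb.1.le).2 (he.mono_set hsub)
    have i4 : IntervalIntegrable (fun u => D u * ((1 - u) * deriv D u)) volume 0 b :=
      i3.continuousOn_mul hcu
    have i5 : IntervalIntegrable (fun u => 2 * (D u * ((1 - u) * deriv D u)) - D u ^ 2)
        volume 0 b := (i4.const_mul 2).sub i1
    have hftc := integral_eq_of_hasDerivAt_off_countable_of_le (fun u => (1 - u) * D u ^ 2)
      (fun u => 2 * (D u * ((1 - u) * deriv D u)) - D u ^ 2) hb.1.le hJ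
      ((continuousOn_const.sub continuousOn_id).mul (hcb.pow 2)) (fun u hu => by
        have h1 := (hd u ⟨⟨hu.1.1, hu.1.2.trans hb.2⟩, hu.2⟩).hasDerivAt
        have h2 := ((hasDerivAt_id u).const_sub 1).mul (h1.pow 2)
        refine h2.congr_deriv ?_
        simp
        ring) i5
    have hle : ∫ u in (0 : ℝ)..b, (2 * (D u * ((1 - u) * deriv D u)) - D u ^ 2)
        ≤ ∫ u in (0 : ℝ)..b, (2 * ((1 - u) * deriv D u) ^ 2 - 1 / 2 * D u ^ 2) := by
      refine intervalIntegral.integral_mono_on hb.1.le i5 ((i2.const_mul 2).sub (i1.const_mul _))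
        fun u _ => ?_
      nlinarith [sq_nonneg (D u - 2 * ((1 - u) * deriv D u))]
    rw [intervalIntegral.integral_sub (i2.const_mul 2) (i1.const_mul _),
      intervalIntegral.integral_const_mul, intervalIntegral.integral_const_mul] at hle
    have hWb : 0 ≤ (1 - b) * D b ^ 2 := mul_nonneg (by linarith [hb.2]) (sq_nonneg _)
    have hfin : ∫ u in (0 : ℝ)..b, D u ^ 2 ≤ 4 * ∫ u in (0 : ℝ)..b, ((1 - u) * deriv D u) ^ 2 := by
      simp only [h0] at hftc
      linarith
    rw [intervalIntegral.integral_of_le hb.1.le, intervalIntegral.integral_of_le hb.1.le] at hfin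
    have i1' := (intervalIntegrable_iff_integrableOn_Ioc_of_le hb.1.le).1 i1
    have i2' := (intervalIntegrable_iff_integrableOn_Ioc_of_le hb.1.le).1 i2
    calc ∫⁻ u in Ioc 0 b, ENNReal.ofReal (D u ^ 2)
        = ENNReal.ofReal (∫ u in Ioc 0 b, D u ^ 2) :=
          (ofReal_integral_eq_lintegral_ofReal i1' (ae_of_all _ fun _ => sq_nonneg _)).symm
      _ ≤ ENNReal.ofReal (4 * ∫ u in Ioc 0 b, ((1 - u) * deriv D u) ^ 2) :=
          ENNReal.ofReal_le_ofReal hfin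
      _ = 4 * ∫⁻ u in Ioc 0 b, ENNReal.ofReal (((1 - u) * deriv D u) ^ 2) := by
          rw [ENNReal.ofReal_mul (by norm_num),
            ofReal_integral_eq_lintegral_ofReal i2' (ae_of_all _ fun _ => sq_nonneg _)]
          norm_num
      _ ≤ _ := by gcongr
  have hU' : (Ioo 0 1 : Set ℝ) = ⋃ n : ℕ, Ioc 0 (1 - 1 / ((n : ℝ) + 2)) := by
    ext u
    simp only [mem_iUnion, mem_Ioc]
    constructor
    · intro hu
      obtain ⟨n, hn⟩ := exists_nat_one_div_lt (sub_pos.2 hu.2)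
      refine ⟨n, hu.1, ?_⟩
      have : 1 / ((n : ℝ) + 2) ≤ 1 / ((n : ℝ) + 1) := by gcongr; norm_num
      linarith
    · rintro ⟨n, h1, h2⟩
      have : 0 < 1 / ((n : ℝ) + 2) := by positivity
      exact ⟨h1, by linarith⟩
  conv_lhs => rw [hU']
  rw [setLIntegral_iUnion_of_directed]
  · refine iSup_le fun n => key _ ⟨?_, ?_⟩
    · have : 1 / ((n : ℝ) + 2) < 1 := by
        rw [div_lt_one (by positivity)]; linarith [n.cast_nonneg (α := ℝ)]
      linarith
    · have : 0 < 1 / ((n : ℝ) + 2) := by positivity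
      linarith
  · refine Monotone.directed_le fun m n hmn => Ioc_subset_Ioc_right ?_
    have : (m : ℝ) ≤ n := by exact_mod_cast hmn
    gcongr

/-- The arithmetic-geometric mean inequality with a quadratic remainder. Here `X` and `Y` are the
derivatives of two quantile functions at `u = 1 - r`. -/
lemma sqrt_mul_one_add_sq_le {X Y r M : ℝ} (hX : 0 < X) (hY : 0 < Y) (hr : 0 ≤ r) (hM : 0 < M)
    (hrX : r * X ≤ M) (hrY : r * Y ≤ M) :
    √X * √Y * (1 + 1 / (8 * M ^ 2) * (r * (X - Y)) ^ 2) ≤ (X + Y) / 2 := by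
  set s := √X with hs
  set t := √Y with ht
  have hs0 : 0 < s := Real.sqrt_pos.2 hX
  have ht0 : 0 < t := Real.sqrt_pos.2 hY
  have hXs : X = s ^ 2 := (Real.sq_sqrt hX.le).symm
  have hYt : Y = t ^ 2 := (Real.sq_sqrt hY.le).symm
  rw [hXs] at hrX ⊢
  rw [hYt] at hrY ⊢
  have h1 : r * (s * t) ≤ M := by nlinarith [mul_nonneg hr (sq_nonneg (s - t))]
  have h2 : r * (s + t) ^ 2 ≤ 4 * M := by nlinarith [mul_nonneg hr (sq_nonneg (s - t))]
  have h3 : (r * (s * t)) * (r * (s + t) ^ 2) ≤ M * (4 * M) :=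
    mul_le_mul h1 h2 (by positivity) hM.le
  have h4 := mul_le_mul_of_nonneg_right h3 (sq_nonneg (s - t))
  have h5 : 1 / (8 * M ^ 2) * ((r * (s * t)) * (r * (s + t) ^ 2) * (s - t) ^ 2)
      ≤ 1 / (8 * M ^ 2) * (M * (4 * M) * (s - t) ^ 2) :=
    mul_le_mul_of_nonneg_left h4 (by positivity)
  have h6 : 1 / (8 * M ^ 2) * (M * (4 * M) * (s - t) ^ 2) = (s - t) ^ 2 / 2 := by
    field_simp; ring
  rw [h6] at h5
  have h7 : s * t * (1 + 1 / (8 * M ^ 2) * (r * (s ^ 2 - t ^ 2)) ^ 2) = s * t +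
      1 / (8 * M ^ 2) * ((r * (s * t)) * (r * (s + t) ^ 2) * (s - t) ^ 2) := by ring
  rw [h7]
  linarith

namespace IsHalfDensity

variable {M : ℝ} {k l : ℝ → ℝ≥0∞}

/-- A quantitative Prékopa–Leindler inequality on the half-line: the excess controls the squared
transport distance between the two densities and any further excess `E` of the integrand. -/
theorem transport_le (hk : IsHalfDensity M k) (hl : IsHalfDensity M l) {w E : ℝ → ℝ≥0∞}
    (h : ∀ u ∈ Ioo (0 : ℝ) 1, (k (halfQuantile k u) * l (halfQuantile l u)) ^ (1 / 2 : ℝ) *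
      (1 + E u) ≤ w ((halfQuantile k u + halfQuantile l u) / 2)) :
    ((∫⁻ s in Ioi 0, k s) * ∫⁻ s in Ioi 0, l s) ^ (1 / 2 : ℝ) *
      (1 + ENNReal.ofReal (1 / (32 * M ^ 2)) *
        (∫⁻ u in Ioo 0 1, ENNReal.ofReal ((halfQuantile k u - halfQuantile l u) ^ 2)) +
        ∫⁻ u in Ioo 0 1, E u) ≤ ∫⁻ s in Ioi 0, w s := by
  have hM := hk.M_pos
  have hA := hk.mass_pos
  have hB := hl.mass_pos
  set D : ℝ → ℝ := fun u => halfQuantile k u - halfQuantile l u with hD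
  have hJ : (jumps k ∪ jumps l).Countable := hk.countable_jumps.union hl.countable_jumps
  set S : Set ℝ := Ioo 0 1 \ (jumps k ∪ jumps l) with hS
  have hSm : MeasurableSet S := measurableSet_Ioo.diff hJ.measurableSet
  have hSae : S =ᵐ[volume] (Ioo 0 1 : Set ℝ) := sdiff_null_ae_eq_self (hJ.measure_zero _)
  have hdk : ∀ u ∈ S, HasDerivAt (halfQuantile k) (mass k / (k (halfQuantile k u)).toReal) u :=
    fun u hu => hk.hasDerivAt_halfQuantile hu.1 fun hj => hu.2 (Or.inl hj)
  have hdl : ∀ u ∈ S, HasDerivAt (halfQuantile l) (mass l / (l (halfQuantile l u)).toReal) u :=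
    fun u hu => hl.hasDerivAt_halfQuantile hu.1 fun hj => hu.2 (Or.inr hj)
  have hD0 : D 0 = 0 := by simp [hD, hk.halfQuantile_zero, hl.halfQuantile_zero]
  have hardy := lintegral_sq_le_of_hardy hJ
    (hk.continuousOn_halfQuantile.sub hl.continuousOn_halfQuantile) hD0
    fun u hu => ((hdk u hu).sub (hdl u hu)).differentiableAt
  have hinj : InjOn (fun u => (halfQuantile k u + halfQuantile l u) / 2) S := by
    refine StrictMonoOn.injOn fun u hu v hv huv => ?_
    have hu' : u ∈ Ico (0 : ℝ) 1 := ⟨hu.1.1.le, hu.1.2⟩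
    have hv' : v ∈ Ico (0 : ℝ) 1 := ⟨hv.1.1.le, hv.1.2⟩
    have h1 := hk.halfQuantile_lt hu' hv' huv
    have h2 := hl.halfQuantile_lt hu' hv' huv
    linarith
  have hcv := lintegral_image_eq_lintegral_abs_deriv_mul hSm
    (f := fun u => (halfQuantile k u + halfQuantile l u) / 2)
    (fun u hu => (((hdk u hu).add (hdl u hu)).div_const 2).hasDerivWithinAt) hinj w
  have hAB : ((∫⁻ s in Ioi 0, k s) * ∫⁻ s in Ioi 0, l s) ^ (1 / 2 : ℝ)
      = ENNReal.ofReal √(mass k * mass l) := by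
    rw [← hk.ofReal_mass, ← hl.ofReal_mass, ← ENNReal.ofReal_mul hA.le,
      ENNReal.ofReal_rpow_of_nonneg (by positivity) (by norm_num), Real.sqrt_eq_rpow]
  have hpt : ∀ u ∈ S, ENNReal.ofReal √(mass k * mass l) *
      (ENNReal.ofReal (1 / (8 * M ^ 2)) * ENNReal.ofReal (((1 - u) * deriv D u) ^ 2) + (1 + E u))
      ≤ ENNReal.ofReal |(mass k / (k (halfQuantile k u)).toReal +
          mass l / (l (halfQuantile l u)).toReal) / 2| *
        w ((halfQuantile k u + halfQuantile l u) / 2) := by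
    intro u hu
    have hα := hk.density_halfQuantile_pos hu.1
    have hβ := hl.density_halfQuantile_pos hu.1
    have hderiv : deriv D u = mass k / (k (halfQuantile k u)).toReal -
        mass l / (l (halfQuantile l u)).toReal := ((hdk u hu).sub (hdl u hu)).deriv
    have hkα := ENNReal.ofReal_toReal (hk.ne_top (hk.halfQuantile_pos hu.1))
    have hlβ := ENNReal.ofReal_toReal (hl.ne_top (hl.halfQuantile_pos hu.1))
    have hw := h u hu.1
    rw [← hkα, ← hlβ, ← ENNReal.ofReal_mul hα.le,
      ENNReal.ofReal_rpow_of_nonneg (by positivity) (by norm_num), ← Real.sqrt_eq_rpow] at hw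
    have hrX : (1 - u) * (mass k / (k (halfQuantile k u)).toReal) ≤ M := by
      rw [mul_div_assoc', div_le_iff₀ hα]; exact hk.one_sub_mul_mass_le hu.1
    have hrY : (1 - u) * (mass l / (l (halfQuantile l u)).toReal) ≤ M := by
      rw [mul_div_assoc', div_le_iff₀ hβ]; exact hl.one_sub_mul_mass_le hu.1
    rw [hderiv]
    set α := (k (halfQuantile k u)).toReal
    set β := (l (halfQuantile l u)).toReal
    have hX : 0 < mass k / α := div_pos hA hα
    have hY : 0 < mass l / β := div_pos hB hβ
    have hreal := sqrt_mul_one_add_sq_le hX hY (sub_nonneg.2 hu.1.2.le) hM hrX hrY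
    set q := 1 / (8 * M ^ 2) * ((1 - u) * (mass k / α - mass l / β)) ^ 2 with hq
    have hq0 : 0 ≤ q := by positivity
    have hreal' : √(mass k * mass l) * (1 + q) ≤ (mass k / α + mass l / β) / 2 * √(α * β) := by
      have hsq : √(mass k / α) * √(mass l / β) * √(α * β) = √(mass k * mass l) := by
        rw [← Real.sqrt_mul hX.le, ← Real.sqrt_mul (by positivity)]
        congr 1
        field_simp
      rw [← hsq]
      have := mul_le_mul_of_nonneg_right hreal (Real.sqrt_nonneg (α * β))
      linarith
    rw [abs_of_pos (by positivity), ← ENNReal.ofReal_mul (by positivity), ← hq]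
    calc ENNReal.ofReal √(mass k * mass l) * (ENNReal.ofReal q + (1 + E u))
        ≤ ENNReal.ofReal √(mass k * mass l) * (ENNReal.ofReal (1 + q) * (1 + E u)) := by
          gcongr
          rw [ENNReal.ofReal_add zero_le_one hq0, ENNReal.ofReal_one, add_mul, one_mul, add_comm]
          gcongr
          exact le_mul_of_one_le_right zero_le le_self_add
      _ = ENNReal.ofReal (√(mass k * mass l) * (1 + q)) * (1 + E u) := by
          rw [ENNReal.ofReal_mul (Real.sqrt_nonneg _), mul_assoc]
      _ ≤ ENNReal.ofReal ((mass k / α + mass l / β) / 2 * √(α * β)) * (1 + E u) := by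
          gcongr
      _ = ENNReal.ofReal ((mass k / α + mass l / β) / 2) *
            (ENNReal.ofReal √(α * β) * (1 + E u)) := by
          rw [ENNReal.ofReal_mul (by positivity), mul_assoc]
      _ ≤ _ := by gcongr
  have hsub : (fun u => (halfQuantile k u + halfQuantile l u) / 2) '' S ⊆ Ioi 0 := by
    rintro _ ⟨u, hu, rfl⟩
    have h1 := hk.halfQuantile_pos hu.1
    have h2 := hl.halfQuantile_pos hu.1
    exact half_pos (add_pos h1 h2)
  refine le_trans ?_ (lintegral_mono_set hsub)
  rw [hcv, hAB]
  refine le_trans ?_ (setLIntegral_mono' hSm hpt)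
  rw [lintegral_const_mul' _ _ ENNReal.ofReal_ne_top]
  gcongr
  have hdm : Measurable fun u => ENNReal.ofReal (((1 - u) * deriv D u) ^ 2) :=
    (((measurable_const.sub measurable_id).mul (measurable_deriv D)).pow_const 2).ennreal_ofReal
  rw [setLIntegral_congr hSae, lintegral_add_left (hdm.const_mul _),
    lintegral_add_left measurable_const, lintegral_const_mul _ hdm]
  have hκ : ENNReal.ofReal (1 / (8 * M ^ 2)) = ENNReal.ofReal (1 / (32 * M ^ 2)) * 4 := by
    rw [show (4 : ℝ≥0∞) = ENNReal.ofReal 4 by norm_num, ← ENNReal.ofReal_mul (by positivity)]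
    congr 1
    field_simp
    norm_num
  have h1 : ∫⁻ _ in Ioo (0 : ℝ) 1, (1 : ℝ≥0∞) = 1 := by simp
  rw [h1, hκ, mul_assoc, ← add_assoc, add_comm _ (1 : ℝ≥0∞)]
  gcongr
  exact hardy

end IsHalfDensity

/-! ### Symmetric unimodal densities on the line -/

/-- The uniform probability measure on `(-1, 1)`, as the average of the uniform measure on `(0, 1)`
and its reflection. -/
noncomputable def signedUniform : Measure ℝ :=
  (2⁻¹ : ℝ≥0∞) • (volume.restrict (Ioo 0 1) + (volume.restrict (Ioo 0 1)).map Neg.neg)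

/-- The odd extension of `halfQuantile k`. -/
noncomputable def signedQuantile (k : ℝ → ℝ≥0∞) (u : ℝ) : ℝ :=
  if u < 0 then -halfQuantile k (-u) else halfQuantile k u

/-- The density `k` on the line is even and non-increasing away from the origin, vanishes outside
`[-M, M]`, and has positive finite mass. -/
structure IsLineDensity (M : ℝ) (k : ℝ → ℝ≥0∞) : Prop where
  measurable : Measurable k
  anti : ∀ s t, |s| ≤ |t| → k t ≤ k s
  eq_zero : ∀ s, M < |s| → k s = 0
  mass_ne_zero : ∫⁻ s, k s ≠ 0
  mass_ne_top : ∫⁻ s, k s ≠ ∞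

instance : IsProbabilityMeasure signedUniform := by
  refine ⟨?_⟩
  rw [signedUniform, Measure.smul_apply, Measure.add_apply,
    Measure.map_apply measurable_neg MeasurableSet.univ]
  simp [← two_mul, ENNReal.inv_mul_cancel]

lemma lintegral_signedUniform {ψ : ℝ → ℝ≥0∞} (hψ : Measurable ψ) :
    ∫⁻ u, ψ u ∂signedUniform = 2⁻¹ * ∫⁻ u in Ioo 0 1, (ψ u + ψ (-u)) := by
  rw [signedUniform, lintegral_smul_measure, lintegral_add_measure,
    lintegral_map hψ measurable_neg, lintegral_add_left hψ, smul_eq_mul]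

lemma lintegral_real_eq_Ioi {ψ : ℝ → ℝ≥0∞} (hψ : Measurable ψ) :
    ∫⁻ s, ψ s = ∫⁻ s in Ioi 0, (ψ s + ψ (-s)) := by
  rw [lintegral_add_left hψ, ← lintegral_add_compl ψ (measurableSet_Ioi (a := (0 : ℝ)))]
  congr 1
  rw [compl_Ioi, setLIntegral_congr Iio_ae_eq_Iic.symm,
    ← (Measure.measurePreserving_neg (volume : Measure ℝ)).setLIntegral_comp_preimage
      measurableSet_Iio hψ]
  congr 2
  ext s; simp

lemma signedQuantile_of_pos (k : ℝ → ℝ≥0∞) {u : ℝ} (hu : 0 < u) :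
    signedQuantile k u = halfQuantile k u := by simp [signedQuantile, hu.le]

lemma signedQuantile_neg (k : ℝ → ℝ≥0∞) {u : ℝ} (hu : 0 < u) :
    signedQuantile k (-u) = -halfQuantile k u := by simp [signedQuantile, hu]

lemma measurable_halfQuantile {α : Type} [MeasurableSpace α] {k : α → ℝ → ℝ≥0∞}
    (hk : Measurable (Function.uncurry k)) :
    Measurable fun p : α × ℝ => halfQuantile (k p.1) p.2 := by
  unfold halfQuantile
  refine Measurable.ennreal_toReal ?_
  have hcum : Measurable fun z : (α × ℝ) × ℝ => ∫⁻ s in Ioc 0 z.2, k z.1.1 s := by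
    have : ∀ z : (α × ℝ) × ℝ, ∫⁻ s in Ioc 0 z.2, k z.1.1 s
        = ∫⁻ s, {p : ((α × ℝ) × ℝ) × ℝ | 0 < p.2 ∧ p.2 ≤ p.1.2}.indicator
          (fun p => k p.1.1.1 p.2) (z, s) := fun z => by
      rw [← lintegral_indicator measurableSet_Ioc]; rfl
    simp_rw [this]
    refine Measurable.lintegral_prod_right' (Measurable.indicator ?_ ?_)
    · exact hk.comp (measurable_fst.fst.fst.prodMk measurable_snd)
    · exact (measurableSet_lt measurable_const measurable_snd).inter
        (measurableSet_le measurable_snd measurable_fst.snd)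
  have hmass : Measurable fun a => ∫⁻ s in Ioi 0, k a s := Measurable.lintegral_prod_right' hk
  have hS : MeasurableSet {z : (α × ℝ) × ℝ | 0 < z.2 ∧ ∫⁻ s in Ioc 0 z.2, k z.1.1 s
      < ENNReal.ofReal z.1.2 * ∫⁻ s in Ioi 0, k z.1.1 s} :=
    (measurableSet_lt measurable_const measurable_snd).inter
      (measurableSet_lt hcum
        (measurable_fst.snd.ennreal_ofReal.mul (hmass.comp measurable_fst.fst)))
  exact measurable_measure_prodMk_left hS

lemma measurable_signedQuantile {α : Type} [MeasurableSpace α] {k : α → ℝ → ℝ≥0∞}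
    (hk : Measurable (Function.uncurry k)) :
    Measurable fun p : α × ℝ => signedQuantile (k p.1) p.2 := by
  have h := measurable_halfQuantile hk
  exact Measurable.ite (measurableSet_lt measurable_snd measurable_const)
    (h.comp (measurable_fst.prodMk measurable_snd.neg)).neg h

namespace IsLineDensity

variable {M : ℝ} {k l : ℝ → ℝ≥0∞}

lemma neg_apply (hk : IsLineDensity M k) (s : ℝ) : k (-s) = k s :=
  le_antisymm (hk.anti _ _ (by simp)) (hk.anti _ _ (by simp))

lemma mass_eq (hk : IsLineDensity M k) : ∫⁻ s, k s = 2 * ∫⁻ s in Ioi 0, k s := by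
  rw [lintegral_real_eq_Ioi hk.measurable, ← lintegral_const_mul _ hk.measurable]
  simp_rw [hk.neg_apply, two_mul]

lemma isHalfDensity (hk : IsLineDensity M k) : IsHalfDensity M k where
  measurable := hk.measurable
  antitoneOn s hs t ht hst := hk.anti s t (by
    rwa [abs_of_pos (show 0 < s from hs), abs_of_pos (show 0 < t from ht)])
  eq_zero s hs := hk.eq_zero s (hs.trans_le (le_abs_self s))
  mass_ne_zero h := hk.mass_ne_zero (by rw [hk.mass_eq, h, mul_zero])
  mass_ne_top h := hk.mass_ne_top (by rw [hk.mass_eq, h]; simp)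

lemma ne_top (hk : IsLineDensity M k) {s : ℝ} (hs : s ≠ 0) : k s ≠ ∞ := by
  rcases hs.lt_or_gt with h | h
  · rw [← hk.neg_apply]
    exact hk.isHalfDensity.ne_top (neg_pos.2 h)
  · exact hk.isHalfDensity.ne_top h

lemma measurable_quantile (hk : IsLineDensity M k) : Measurable (signedQuantile k) :=
  (measurable_signedQuantile (α := Unit) (k := fun _ => k)
    (hk.measurable.comp measurable_snd)).comp ((measurable_const (a := ())).prodMk measurable_id)

lemma density_quantile (hk : IsLineDensity M k) {u : ℝ} (hu : u ∈ Ioo 0 1 ∨ -u ∈ Ioo 0 1) :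
    k (signedQuantile k u) ≠ 0 ∧ k (signedQuantile k u) ≠ ∞ := by
  have key : ∀ v ∈ Ioo (0 : ℝ) 1, k (halfQuantile k v) ≠ 0 ∧ k (halfQuantile k v) ≠ ∞ := by
    intro v hv
    have := hk.isHalfDensity.density_halfQuantile_pos hv
    rw [ENNReal.toReal_pos_iff] at this
    exact ⟨this.1.ne', this.2.ne⟩
  rcases hu with hu | hu
  · rw [signedQuantile_of_pos k hu.1]
    exact key u hu
  · rw [← neg_neg u, signedQuantile_neg k hu.1, hk.neg_apply]
    exact key _ hu

/-- The signed quantile function pushes the uniform law on `(-1, 1)` to the normalised density. -/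
lemma lintegral_mul_eq (hk : IsLineDensity M k) {ψ : ℝ → ℝ≥0∞} (hψ : Measurable ψ) :
    ∫⁻ s, ψ s * k s = (∫⁻ s, k s) * ∫⁻ u, ψ (signedQuantile k u) ∂signedUniform := by
  rw [lintegral_real_eq_Ioi (ψ := fun s => ψ s * k s) (hψ.mul hk.measurable)]
  simp_rw [hk.neg_apply, ← add_mul]
  rw [hk.isHalfDensity.lintegral_mul_eq fun s => ψ s + ψ (-s),
    lintegral_signedUniform (ψ := fun u => ψ (signedQuantile k u))
      (hψ.comp hk.measurable_quantile), hk.mass_eq, mul_comm 2, mul_assoc,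
    ← mul_assoc 2, ENNReal.mul_inv_cancel two_ne_zero ENNReal.ofNat_ne_top, one_mul]
  congr 1
  refine setLIntegral_congr_fun measurableSet_Ioo fun u hu => ?_
  simp only [signedQuantile_of_pos k hu.1, signedQuantile_neg k hu.1]

/-- The line version of `IsHalfDensity.transport_le`, by addition of the estimates for the two
half-lines. -/
theorem transport_le (hk : IsLineDensity M k) (hl : IsLineDensity M l) {w E : ℝ → ℝ≥0∞}
    (hw : Measurable w) (hE : Measurable E)
    (h : ∀ u, u ∈ Ioo (0 : ℝ) 1 ∨ -u ∈ Ioo (0 : ℝ) 1 →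
      (k (signedQuantile k u) * l (signedQuantile l u)) ^ (1 / 2 : ℝ) * (1 + E u)
        ≤ w ((signedQuantile k u + signedQuantile l u) / 2)) :
    ((∫⁻ s, k s) * ∫⁻ s, l s) ^ (1 / 2 : ℝ) *
      (1 + ENNReal.ofReal (1 / (32 * M ^ 2)) *
        (∫⁻ u, ENNReal.ofReal ((signedQuantile k u - signedQuantile l u) ^ 2) ∂signedUniform) +
        ∫⁻ u, E u ∂signedUniform) ≤ ∫⁻ s, w s := by
  have hp := hk.isHalfDensity.transport_le hl.isHalfDensity (w := w) (E := E) fun u hu => by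
    have := h u (Or.inl hu)
    rwa [signedQuantile_of_pos k hu.1, signedQuantile_of_pos l hu.1] at this
  have hn := hk.isHalfDensity.transport_le hl.isHalfDensity (w := fun s => w (-s))
    (E := fun u => E (-u)) fun u hu => by
    have := h (-u) (Or.inr (by rwa [neg_neg]))
    rw [signedQuantile_neg k hu.1, signedQuantile_neg l hu.1, hk.neg_apply, hl.neg_apply] at this
    rwa [neg_div', neg_add]
  have hsum := add_le_add hp hn
  have hdm : Measurable fun u => ENNReal.ofReal ((signedQuantile k u - signedQuantile l u) ^ 2) :=
    ((hk.measurable_quantile.sub hl.measurable_quantile).pow_const 2).ennreal_ofReal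
  rw [lintegral_real_eq_Ioi hw, lintegral_add_left hw]
  refine le_trans (le_of_eq ?_) hsum
  rw [lintegral_signedUniform hdm, lintegral_signedUniform hE, lintegral_add_left hE]
  have hd : ∫⁻ u in Ioo (0 : ℝ) 1,
      (ENNReal.ofReal ((signedQuantile k u - signedQuantile l u) ^ 2) +
        ENNReal.ofReal ((signedQuantile k (-u) - signedQuantile l (-u)) ^ 2))
      = 2 * ∫⁻ u in Ioo (0 : ℝ) 1,
        ENNReal.ofReal ((halfQuantile k u - halfQuantile l u) ^ 2) := by
    rw [← lintegral_const_mul' _ _ ENNReal.ofNat_ne_top]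
    refine setLIntegral_congr_fun measurableSet_Ioo fun u hu => ?_
    simp only [signedQuantile_of_pos k hu.1, signedQuantile_of_pos l hu.1,
      signedQuantile_neg k hu.1, signedQuantile_neg l hu.1]
    rw [two_mul]
    congr 2
    ring
  have hsq : ((∫⁻ s, k s) * ∫⁻ s, l s) ^ (1 / 2 : ℝ)
      = 2 * ((∫⁻ s in Ioi 0, k s) * ∫⁻ s in Ioi 0, l s) ^ (1 / 2 : ℝ) := by
    rw [hk.mass_eq, hl.mass_eq, mul_mul_mul_comm,
      ENNReal.mul_rpow_of_nonneg _ _ (by norm_num : (0 : ℝ) ≤ 1 / 2), ← sq, ← ENNReal.rpow_natCast,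
      ← ENNReal.rpow_mul]
    norm_num
  rw [hd, hsq, ← mul_assoc 2⁻¹ 2, ENNReal.inv_mul_cancel two_ne_zero ENNReal.ofNat_ne_top, one_mul]
  set κ := ENNReal.ofReal (1 / (32 * M ^ 2)) *
    ∫⁻ u in Ioo (0 : ℝ) 1, ENNReal.ofReal ((halfQuantile k u - halfQuantile l u) ^ 2)
  set P := ((∫⁻ s in Ioi 0, k s) * ∫⁻ s in Ioi 0, l s) ^ (1 / 2 : ℝ)
  set a := ∫⁻ u in Ioo (0 : ℝ) 1, E u
  set b := ∫⁻ u in Ioo (0 : ℝ) 1, E (-u)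
  calc 2 * P * (1 + κ + 2⁻¹ * (a + b)) = P * (2 * (1 + κ) + 2 * 2⁻¹ * (a + b)) := by ring
    _ = P * (1 + κ + a) + P * (1 + κ + b) := by
      rw [ENNReal.mul_inv_cancel two_ne_zero ENNReal.ofNat_ne_top]; ring

end IsLineDensity

/-! ### The Knothe map and the transport inequality in the box -/

/-- The density `f` on `ℝⁿ` is a function of the absolute values of the coordinates, non-increasing
in each of them, vanishes outside `[-M, M]ⁿ`, and has positive finite mass. -/
structure IsBoxDensity {n : ℕ} (M : ℝ) (f : (Fin n → ℝ) → ℝ≥0∞) : Prop where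
  measurable : Measurable f
  anti : ∀ x y, (∀ i, |x i| ≤ |y i|) → f y ≤ f x
  eq_zero : ∀ x i, M < |x i| → f x = 0
  mass_ne_zero : ∫⁻ x, f x ≠ 0
  mass_ne_top : ∫⁻ x, f x ≠ ∞

/-- The density of the first coordinate under the density `f`. -/
noncomputable def firstMarginal {n : ℕ} (f : (Fin (n + 1) → ℝ) → ℝ≥0∞) (s : ℝ) : ℝ≥0∞ :=
  ∫⁻ x : Fin n → ℝ, f (Fin.cons s x)

/-- The Knothe map from the uniform law on `(-1, 1)ⁿ` to the normalised density `f`: the first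
coordinate is the quantile of the first marginal, and the other coordinates are the Knothe map of
the slice of `f` at that point. -/
noncomputable def knothe : (n : ℕ) → ((Fin n → ℝ) → ℝ≥0∞) → (Fin n → ℝ) → Fin n → ℝ
  | 0, _, u => u
  | n + 1, f, u => Fin.cons (signedQuantile (firstMarginal f) (u 0))
      (knothe n (fun x => f (Fin.cons (signedQuantile (firstMarginal f) (u 0)) x)) (Fin.tail u))

lemma knothe_cons {n : ℕ} (f : (Fin (n + 1) → ℝ) → ℝ≥0∞) (u : ℝ) (v : Fin n → ℝ) :
    knothe (n + 1) f (Fin.cons u v) = Fin.cons (signedQuantile (firstMarginal f) u)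
      (knothe n (fun x => f (Fin.cons (signedQuantile (firstMarginal f) u) x)) v) := by
  simp only [knothe, Fin.cons_zero, Fin.tail_cons]

lemma measurable_fin_cons {n : ℕ} :
    Measurable fun p : ℝ × (Fin n → ℝ) => (Fin.cons p.1 p.2 : Fin (n + 1) → ℝ) := by
  rw [measurable_pi_iff]
  intro i
  refine Fin.cases ?_ (fun j => ?_) i
  · simpa using measurable_fst
  · simpa [Function.comp_def] using (measurable_pi_apply j).comp (measurable_snd (α := ℝ))

lemma lintegral_pi_succ {n : ℕ} (μ : Measure ℝ) [SigmaFinite μ] {F : (Fin (n + 1) → ℝ) → ℝ≥0∞}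
    (hF : Measurable F) :
    ∫⁻ z, F z ∂Measure.pi (fun _ => μ)
      = ∫⁻ s, ∫⁻ x, F (Fin.cons s x) ∂Measure.pi (fun _ => μ) ∂μ := by
  have h := (measurePreserving_piFinSuccAbove (fun _ : Fin (n + 1) => μ) 0).symm
  rw [← h.lintegral_comp hF, lintegral_prod _ (by exact (hF.comp h.measurable).aemeasurable)]
  simp [MeasurableEquiv.piFinSuccAbove, Fin.insertNthEquiv]

lemma lintegral_volume_pi_succ {n : ℕ} {F : (Fin (n + 1) → ℝ) → ℝ≥0∞} (hF : Measurable F) :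
    ∫⁻ z, F z = ∫⁻ s, ∫⁻ x : Fin n → ℝ, F (Fin.cons s x) := lintegral_pi_succ volume hF

lemma measurable_knothe : ∀ (n : ℕ) {α : Type} [MeasurableSpace α]
    {f : α → (Fin n → ℝ) → ℝ≥0∞}, Measurable (Function.uncurry f) →
    Measurable fun p : α × (Fin n → ℝ) => knothe n (f p.1) p.2
  | 0, _, _, _, _ => measurable_snd
  | n + 1, α, _, f, hf => by
    have hf' : Measurable fun p : (α × ℝ) × (Fin n → ℝ) => f p.1.1 (Fin.cons p.1.2 p.2) :=
      hf.comp (measurable_fst.fst.prodMk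
        (measurable_fin_cons.comp (measurable_fst.snd.prodMk measurable_snd)))
    have hm : Measurable (Function.uncurry fun a => firstMarginal (f a)) :=
      Measurable.lintegral_prod_right' hf'
    have hq : Measurable fun p : α × (Fin (n + 1) → ℝ) =>
        signedQuantile (firstMarginal (f p.1)) (p.2 0) :=
      (measurable_signedQuantile hm).comp
        (measurable_fst.prodMk ((measurable_pi_apply 0).comp measurable_snd))
    have ih := measurable_knothe n (α := α × ℝ)
      (f := fun p x => f p.1 (Fin.cons p.2 x)) hf'
    have htail : Measurable fun p : α × (Fin (n + 1) → ℝ) => Fin.tail p.2 :=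
      measurable_pi_iff.2 fun i => (measurable_pi_apply i.succ).comp measurable_snd
    exact measurable_fin_cons.comp
      (hq.prodMk (ih.comp ((measurable_fst.prodMk hq).prodMk htail)))

namespace IsBoxDensity

variable {M : ℝ} {n : ℕ}

lemma measurable_slice {f : (Fin (n + 1) → ℝ) → ℝ≥0∞} (hf : Measurable f) :
    Measurable (Function.uncurry fun (s : ℝ) (x : Fin n → ℝ) => f (Fin.cons s x)) :=
  hf.comp measurable_fin_cons

lemma measurable_firstMarginal {f : (Fin (n + 1) → ℝ) → ℝ≥0∞} (hf : Measurable f) :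
    Measurable (firstMarginal f) :=
  Measurable.lintegral_prod_right' (measurable_slice hf)

lemma lintegral_firstMarginal {f : (Fin (n + 1) → ℝ) → ℝ≥0∞} (hf : Measurable f) :
    ∫⁻ s, firstMarginal f s = ∫⁻ x, f x := (lintegral_volume_pi_succ hf).symm

lemma isLineDensity {f : (Fin (n + 1) → ℝ) → ℝ≥0∞} (hf : IsBoxDensity M f) :
    IsLineDensity M (firstMarginal f) where
  measurable := measurable_firstMarginal hf.measurable
  anti s t hst := lintegral_mono fun x => hf.anti _ _ fun i => by
    refine Fin.cases ?_ (fun j => ?_) i <;> simp [hst]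
  eq_zero s hs := by
    have : ∀ x : Fin n → ℝ, f (Fin.cons s x) = 0 := fun x => hf.eq_zero _ 0 (by simpa using hs)
    simp [firstMarginal, this]
  mass_ne_zero := by rw [lintegral_firstMarginal hf.measurable]; exact hf.mass_ne_zero
  mass_ne_top := by rw [lintegral_firstMarginal hf.measurable]; exact hf.mass_ne_top

lemma slice {f : (Fin (n + 1) → ℝ) → ℝ≥0∞} (hf : IsBoxDensity M f) {s : ℝ}
    (hs : firstMarginal f s ≠ 0 ∧ firstMarginal f s ≠ ∞) :
    IsBoxDensity M fun x : Fin n → ℝ => f (Fin.cons s x) where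
  measurable := (measurable_slice hf.measurable).comp (measurable_const.prodMk measurable_id)
  anti x y hxy := hf.anti _ _ fun i => by
    refine Fin.cases ?_ (fun j => ?_) i <;> simp [hxy]
  eq_zero x i hi := hf.eq_zero _ i.succ (by simpa using hi)
  mass_ne_zero := hs.1
  mass_ne_top := hs.2

lemma measurable_knothe {f : (Fin n → ℝ) → ℝ≥0∞} (hf : Measurable f) : Measurable (knothe n f) :=
  (_root_.measurable_knothe n (α := Unit) (f := fun _ => f) (hf.comp measurable_snd)).comp
    ((measurable_const (a := ())).prodMk measurable_id)

/-- The Knothe map pushes the uniform law on `(-1, 1)ⁿ` to the normalised density. -/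
theorem lintegral_mul_eq : ∀ {n : ℕ} {f : (Fin n → ℝ) → ℝ≥0∞}, IsBoxDensity M f →
    ∀ {ψ : (Fin n → ℝ) → ℝ≥0∞}, Measurable ψ →
    ∫⁻ x, ψ x * f x
      = (∫⁻ x, f x) * ∫⁻ u, ψ (knothe n f u) ∂Measure.pi fun _ => signedUniform
  | 0, f, _, ψ, _ => by
    rw [volume_pi, Measure.pi_of_empty, Measure.pi_of_empty, lintegral_dirac, lintegral_dirac,
      lintegral_dirac, mul_comm]
    rfl
  | n + 1, f, hf, ψ, hψ => by
    have hk := hf.isLineDensity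
    have hkn : Measurable fun u => ψ (knothe (n + 1) f u) :=
      hψ.comp (measurable_knothe hf.measurable)
    have hmap : Measurable fun p : ℝ × (Fin n → ℝ) =>
        ψ (Fin.cons p.1 (knothe n (fun x => f (Fin.cons p.1 x)) p.2)) :=
      hψ.comp (measurable_fin_cons.comp (measurable_fst.prodMk
        (_root_.measurable_knothe n (measurable_slice hf.measurable))))
    have hΨ : Measurable fun s => ∫⁻ v, ψ (Fin.cons s (knothe n (fun x => f (Fin.cons s x)) v))
        ∂Measure.pi fun _ => signedUniform := Measurable.lintegral_prod_right' hmap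
    rw [lintegral_volume_pi_succ (F := fun x => ψ x * f x) (hψ.mul hf.measurable),
      lintegral_pi_succ _ hkn, ← lintegral_firstMarginal hf.measurable]
    simp_rw [knothe_cons]
    rw [← hk.lintegral_mul_eq hΨ]
    refine lintegral_congr_ae ?_
    -- The slice at `0` is discarded because it may have infinite mass.
    filter_upwards [(countable_singleton (0 : ℝ)).ae_notMem volume] with s hs
    by_cases h0 : firstMarginal f s = 0
    · rw [h0, mul_zero]
      have hms : Measurable fun x : Fin n → ℝ => f (Fin.cons s x) :=
        (measurable_slice hf.measurable).comp (measurable_const.prodMk measurable_id)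
      have := (lintegral_eq_zero_iff hms).1 h0
      rw [lintegral_congr_ae (g := fun _ => 0)]
      · simp
      · filter_upwards [this] with x hx
        rw [hx]; simp
    · have hsl := hf.slice ⟨h0, hk.ne_top hs⟩
      rw [lintegral_mul_eq hsl (ψ := fun x => ψ (Fin.cons s x))
        (hψ.comp (measurable_fin_cons.comp (measurable_const.prodMk measurable_id))), mul_comm]
      rfl

/-- A quantitative Prékopa–Leindler inequality: the excess controls the squared distance between
the Knothe maps. The inequality for the slices serves as the additional excess in
`IsLineDensity.transport_le` for the first marginals. -/
theorem transport_le : ∀ {n : ℕ} {f g h : (Fin n → ℝ) → ℝ≥0∞}, IsBoxDensity M f →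
    IsBoxDensity M g → Measurable h →
    (∀ x y, (f x * g y) ^ (1 / 2 : ℝ) ≤ h fun i => (x i + y i) / 2) →
    ((∫⁻ x, f x) * ∫⁻ x, g x) ^ (1 / 2 : ℝ) * (1 + ENNReal.ofReal (1 / (32 * M ^ 2)) *
      ∫⁻ u, ∑ i, ENNReal.ofReal ((knothe n f u i - knothe n g u i) ^ 2)
        ∂Measure.pi fun _ => signedUniform) ≤ ∫⁻ x, h x
  | 0, f, g, h, _, _, _, hfg => by
    simp only [Finset.univ_eq_empty, Finset.sum_empty, lintegral_zero, mul_zero, add_zero, mul_one]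
    rw [volume_pi, Measure.pi_of_empty, lintegral_dirac, lintegral_dirac, lintegral_dirac]
    exact (hfg _ _).trans_eq (congrArg h (Subsingleton.elim _ _))
  | n + 1, f, g, h, hf, hg, hh, hfg => by
    have hk := hf.isLineDensity
    have hl := hg.isLineDensity
    set X := signedQuantile (firstMarginal f)
    set Y := signedQuantile (firstMarginal g)
    have hX : Measurable X := hk.measurable_quantile
    have hY : Measurable Y := hl.measurable_quantile
    set Φ : ℝ → (Fin n → ℝ) → Fin n → ℝ := fun u v => knothe n (fun x => f (Fin.cons (X u) x)) v
    set Γ : ℝ → (Fin n → ℝ) → Fin n → ℝ := fun u v => knothe n (fun x => g (Fin.cons (Y u) x)) v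
    have hΦ : Measurable fun p : ℝ × (Fin n → ℝ) => Φ p.1 p.2 :=
      (_root_.measurable_knothe n (measurable_slice hf.measurable)).comp
        ((hX.comp measurable_fst).prodMk measurable_snd)
    have hΓ : Measurable fun p : ℝ × (Fin n → ℝ) => Γ p.1 p.2 :=
      (_root_.measurable_knothe n (measurable_slice hg.measurable)).comp
        ((hY.comp measurable_fst).prodMk measurable_snd)
    have hcost : Measurable fun p : ℝ × (Fin n → ℝ) =>
        ∑ i, ENNReal.ofReal ((Φ p.1 p.2 i - Γ p.1 p.2 i) ^ 2) :=
      Finset.measurable_sum _ fun i _ => (((measurable_pi_apply i).comp hΦ).sub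
        ((measurable_pi_apply i).comp hΓ)).pow_const 2 |>.ennreal_ofReal
    set K : ℝ → ℝ≥0∞ := fun u => ∫⁻ v, ∑ i, ENNReal.ofReal ((Φ u v i - Γ u v i) ^ 2)
      ∂Measure.pi fun _ => signedUniform with hK
    have hKm : Measurable K := Measurable.lintegral_prod_right' hcost
    have hstep := hk.transport_le hl (measurable_firstMarginal hh)
      (hKm.const_mul (ENNReal.ofReal (1 / (32 * M ^ 2)))) fun u hu => by
        refine transport_le (hf.slice (hk.density_quantile hu)) (hg.slice (hl.density_quantile hu))
          ((measurable_slice hh).comp (measurable_const.prodMk measurable_id)) fun x y => ?_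
        refine (hfg _ _).trans_eq (congrArg h (funext fun i => ?_))
        refine Fin.cases ?_ (fun j => ?_) i <;> simp
    rw [lintegral_firstMarginal hf.measurable, lintegral_firstMarginal hg.measurable,
      lintegral_firstMarginal hh, lintegral_const_mul _ hKm, add_assoc, ← mul_add] at hstep
    refine le_trans (le_of_eq ?_) hstep
    congr 3
    have hm : Measurable fun u => ∑ i, ENNReal.ofReal
        ((knothe (n + 1) f u i - knothe (n + 1) g u i) ^ 2) :=
      Finset.measurable_sum _ fun i _ =>
        (((measurable_pi_apply i).comp (measurable_knothe hf.measurable)).sub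
          ((measurable_pi_apply i).comp (measurable_knothe hg.measurable))).pow_const 2
            |>.ennreal_ofReal
    rw [lintegral_pi_succ _ hm, ← lintegral_add_right _ hKm]
    refine lintegral_congr fun u => ?_
    simp_rw [knothe_cons, Fin.sum_univ_succ, Fin.cons_zero, Fin.cons_succ]
    rw [lintegral_add_left measurable_const]
    simp [hK, X, Y, Φ, Γ]

end IsBoxDensity

/-! ### Lower semicontinuous regularisation -/

/-- The supremum of `k` over the points all of whose coordinates strictly exceed those of `x` in
absolute value. It is lower semicontinuous for every `k`. -/
noncomputable def outerReg {n : ℕ} (k : (Fin n → ℝ) → ℝ≥0∞) (x : Fin n → ℝ) : ℝ≥0∞ :=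
  ⨆ (q : Fin n → ℝ) (_ : ∀ i, |x i| < |q i|), k q

section

variable {n : ℕ} {k : (Fin n → ℝ) → ℝ≥0∞}

lemma le_outerReg {x q : Fin n → ℝ} (h : ∀ i, |x i| < |q i|) : k q ≤ outerReg k x :=
  le_iSup₂ (f := fun (q : Fin n → ℝ) (_ : ∀ i, |x i| < |q i|) => k q) q h

lemma outerReg_anti {x y : Fin n → ℝ} (h : ∀ i, |x i| ≤ |y i|) :
    outerReg k y ≤ outerReg k x :=
  iSup₂_le fun _ hq => le_outerReg fun i => (h i).trans_lt (hq i)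

lemma outerReg_le (hk : ∀ x y : Fin n → ℝ, (∀ i, |x i| ≤ |y i|) → k y ≤ k x) (x : Fin n → ℝ) :
    outerReg k x ≤ k x :=
  iSup₂_le fun q hq => hk x q fun i => (hq i).le

lemma measurable_outerReg : Measurable (outerReg k) := by
  refine LowerSemicontinuous.measurable fun x c hc => ?_
  obtain ⟨q, hq⟩ := lt_iSup_iff.1 hc
  obtain ⟨hxq, hcq⟩ := lt_iSup_iff.1 hq
  have : ∀ᶠ y : Fin n → ℝ in nhds x, ∀ i, |y i| < |q i| :=
    Filter.eventually_all.2 fun i =>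
      (continuous_apply i).abs.continuousAt.eventually_lt continuousAt_const (hxq i)
  filter_upwards [this] with y hy
  exact hcq.trans_le (le_outerReg hy)

lemma lintegral_comp_inv_smul {F : (Fin n → ℝ) → ℝ≥0∞} (hF : Measurable F) {r : ℝ} (hr : 0 < r) :
    ∫⁻ x, F (r⁻¹ • x) = ENNReal.ofReal (r ^ n) * ∫⁻ x, F x := by
  have h := Measure.map_addHaar_smul (volume : Measure (Fin n → ℝ)) (inv_ne_zero hr.ne')
  rw [← lintegral_map hF (measurable_const_smul r⁻¹), h, lintegral_smul_measure]
  simp [abs_of_pos hr]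

lemma ae_coord_ne_zero (n : ℕ) : ∀ᵐ x : Fin n → ℝ, ∀ i, x i ≠ 0 := by
  rw [ae_all_iff]
  intro i
  exact Measure.ae_eval_ne (fun _ : Fin n => (volume : Measure ℝ)) i 0

/-- A function that is non-increasing in the absolute value of each coordinate agrees almost
everywhere with its regularisation `outerReg k`: almost everywhere it lies between `outerReg k` and
the infimum of the dilates of `outerReg k` by factors tending to `1`, which has the same
integral. -/
lemma outerReg_ae_eq (hk : ∀ x y : Fin n → ℝ, (∀ i, |x i| ≤ |y i|) → k y ≤ k x)
    (hfin : ∫⁻ x, outerReg k x ≠ ∞) : outerReg k =ᵐ[volume] k := by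
  set t : ℕ → ℝ := fun m => 1 + 1 / ((m : ℝ) + 1) with ht
  have ht1 : ∀ m, 1 < t m := fun m => by
    have : 0 < 1 / ((m : ℝ) + 1) := by positivity
    simp only [ht]; linarith
  set w : (Fin n → ℝ) → ℝ≥0∞ := fun x => ⨅ m, outerReg k ((t m)⁻¹ • x) with hw
  have hwm : Measurable w :=
    Measurable.iInf fun m => measurable_outerReg.comp (measurable_const_smul _)
  have hkw : ∀ᵐ x, k x ≤ w x := by
    filter_upwards [ae_coord_ne_zero n] with x hx
    refine le_iInf fun m => le_outerReg fun i => ?_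
    rw [Pi.smul_apply, smul_eq_mul, abs_mul, abs_of_pos (inv_pos.2 (one_pos.trans (ht1 m)))]
    exact mul_lt_of_lt_one_left (abs_pos.2 (hx i)) (inv_lt_one_of_one_lt₀ (ht1 m))
  have hint : ∫⁻ x, w x ≤ ∫⁻ x, outerReg k x := by
    have hle : ∀ m, ∫⁻ x, w x ≤ ENNReal.ofReal (t m ^ n) * ∫⁻ x, outerReg k x := fun m => by
      rw [← lintegral_comp_inv_smul measurable_outerReg (one_pos.trans (ht1 m))]
      exact lintegral_mono fun x => iInf_le _ m
    have hlim : Filter.Tendsto (fun m => ENNReal.ofReal (t m ^ n) * ∫⁻ x, outerReg k x)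
        Filter.atTop (nhds (ENNReal.ofReal ((1 + 0) ^ n) * ∫⁻ x, outerReg k x)) := by
      refine ENNReal.Tendsto.mul_const (ENNReal.tendsto_ofReal ?_) (Or.inr hfin)
      exact (tendsto_one_div_add_atTop_nhds_zero_nat.const_add 1).pow n
    have := ge_of_tendsto' hlim hle
    simpa using this
  have hrw : outerReg k ≤ᵐ[volume] w := by
    filter_upwards [hkw] with x hx
    exact (outerReg_le hk x).trans hx
  have heq := ae_eq_of_ae_le_of_lintegral_le hrw hfin hwm.aemeasurable hint
  filter_upwards [heq, hkw] with x h1 h2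
  exact le_antisymm (outerReg_le hk x) (h2.trans_eq h1.symm)

lemma isBoxDensity_outerReg {M : ℝ} (hk : ∀ x y : Fin n → ℝ, (∀ i, |x i| ≤ |y i|) → k y ≤ k x)
    (hsupp : ∀ x i, M < |x i| → k x = 0) (h0 : ∫⁻ x, k x ≠ 0) (htop : ∫⁻ x, k x ≠ ∞) :
    IsBoxDensity M (outerReg k) := by
  have hfin : ∫⁻ x, outerReg k x ≠ ∞ :=
    ne_top_of_le_ne_top htop (lintegral_mono (outerReg_le hk))
  refine ⟨measurable_outerReg, fun _ _ => outerReg_anti, fun x i hi => ?_, ?_, hfin⟩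
  · exact le_antisymm ((outerReg_le hk x).trans_eq (hsupp x i hi)) zero_le
  · rwa [lintegral_congr_ae (outerReg_ae_eq hk hfin)]

/-- Regularisation preserves the hypothesis of the Prékopa–Leindler inequality. -/
lemma outerReg_mul_rpow_le {f g h : (Fin n → ℝ) → ℝ≥0∞}
    (hf : ∀ x y : Fin n → ℝ, (∀ i, |x i| ≤ |y i|) → f y ≤ f x)
    (hg : ∀ x y : Fin n → ℝ, (∀ i, |x i| ≤ |y i|) → g y ≤ g x)
    (hfg : ∀ x y, (f x * g y) ^ (1 / 2 : ℝ) ≤ h fun i => (x i + y i) / 2) (x y : Fin n → ℝ) :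
    (outerReg f x * outerReg g y) ^ (1 / 2 : ℝ) ≤ outerReg h fun i => (x i + y i) / 2 := by
  rw [one_div, ENNReal.rpow_inv_le_iff two_pos]
  simp only [outerReg, ENNReal.iSup_mul, ENNReal.mul_iSup]
  refine iSup_le fun q => iSup_le fun hq => iSup_le fun p => iSup_le fun hp => ?_
  rw [← ENNReal.rpow_inv_le_iff two_pos, ← one_div]
  calc (f p * g q) ^ (1 / 2 : ℝ)
      ≤ (f (fun i => |p i|) * g (fun i => |q i|)) ^ (1 / 2 : ℝ) := by
        gcongr
        · exact hf _ _ fun i => by simp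
        · exact hg _ _ fun i => by simp
    _ ≤ h fun i => (|p i| + |q i|) / 2 := hfg _ _
    _ ≤ outerReg h fun i => (x i + y i) / 2 := le_outerReg fun i => ?_
  have h1 := hq i
  have h2 := hp i
  have h3 := abs_add_le (x i) (y i)
  rw [abs_div, abs_two, abs_of_nonneg (by positivity : 0 ≤ (|p i| + |q i|) / 2)]
  linarith

end

/-! ### Unconditional log-concave densities and the Wasserstein distance -/

section

variable {n : ℕ} {f g : EuclideanSpace ℝ (Fin n) → ℝ}

/-- On a segment joining two mirror points, an unconditional log-concave function is at least its
value at the ends. -/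
lemma IsLogConcave.le_update (hf : IsLogConcave f) (hu : IsUnconditional f)
    (z : Fin n → ℝ) (j : Fin n) {c : ℝ} (hc : |c| ≤ |z j|) :
    f (WithLp.toLp 2 z) ≤ f (WithLp.toLp 2 (Function.update z j c)) := by
  by_cases hz : z j = 0
  · rw [hz, abs_zero] at hc
    rw [abs_nonpos_iff.1 hc, ← hz, Function.update_eq_self]
  set θ := c / z j with hθ
  have hcθ : c = θ * z j := (div_mul_cancel₀ c hz).symm
  have hθ1 : |θ| ≤ 1 := by
    rw [hθ, abs_div]; exact div_le_one_of_le₀ hc (abs_nonneg _)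
  obtain ⟨hθl, hθr⟩ := abs_le.1 hθ1
  rcases hθr.eq_or_lt with h1 | h1
  · rw [hcθ, h1, one_mul, Function.update_eq_self]
  set ε : Fin n → ℝ := Function.update 1 j (-1) with hε
  have hflip : f (WithLp.toLp 2 fun i => ε i * z i) = f (WithLp.toLp 2 z) := by
    refine hu ε (fun i => ?_) (WithLp.toLp 2 z)
    by_cases hi : i = j
    · subst hi; simp [hε]
    · simp [hε, hi]
  rcases hθl.eq_or_lt with h2 | h2
  · rw [← hflip]
    refine le_of_eq (congrArg f (congrArg _ (funext fun i => ?_)))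
    by_cases hi : i = j
    · subst hi; simp [hε, hcθ, ← h2]
    · simp [hε, hi]
  · have h := hf.2 (WithLp.toLp 2 z) (WithLp.toLp 2 fun i => ε i * z i) ((1 + θ) / 2)
      (by linarith) (by linarith)
    rw [hflip, ← Real.rpow_add' (hf.1 _) (by norm_num), add_sub_cancel, Real.rpow_one] at h
    refine h.trans_eq (congrArg f ?_)
    ext i
    by_cases hi : i = j
    · subst hi; simp [hε, hcθ]; ring
    · simp [hε, hi]; ring

/-- An unconditional log-concave function is non-increasing in the absolute value of each
coordinate. The rest of the argument depends on log-concavity only through this property. -/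
lemma IsLogConcave.anti (hf : IsLogConcave f) (hu : IsUnconditional f)
    {x y : EuclideanSpace ℝ (Fin n)} (h : ∀ i, |x i| ≤ |y i|) : f y ≤ f x := by
  classical
  have key : ∀ S : Finset (Fin n), f y ≤ f (WithLp.toLp 2 fun i => if i ∈ S then x i else y i) := by
    intro S
    induction S using Finset.induction_on with
    | empty => simp
    | insert j S hj ih =>
      refine ih.trans ((hf.le_update hu _ j (c := x j) (by simpa [hj] using h j)).trans_eq ?_)
      refine congrArg f (congrArg _ (funext fun i => ?_))
      by_cases hi : i = j
      · subst hi; simp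
      · simp [hi]
  simpa using key Finset.univ

lemma bddAbove_supConv (hf : ∀ x y : EuclideanSpace ℝ (Fin n), (∀ i, |x i| ≤ |y i|) → f y ≤ f x)
    (hg : ∀ x y : EuclideanSpace ℝ (Fin n), (∀ i, |x i| ≤ |y i|) → g y ≤ g x)
    (hf0 : ∀ x, 0 ≤ f x) (hg0 : ∀ x, 0 ≤ g x) (x : EuclideanSpace ℝ (Fin n)) :
    √(f 0 * g 0) ∈ upperBounds
      (range fun y : EuclideanSpace ℝ (Fin n) => √(f (x + y) * g (x - y))) := by
  rintro _ ⟨y, rfl⟩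
  refine Real.sqrt_le_sqrt (mul_le_mul (hf _ _ ?_) (hg _ _ ?_) (hg0 _) (hf0 _)) <;> simp

lemma supConv_anti (hf : ∀ x y : EuclideanSpace ℝ (Fin n), (∀ i, |x i| ≤ |y i|) → f y ≤ f x)
    (hg : ∀ x y : EuclideanSpace ℝ (Fin n), (∀ i, |x i| ≤ |y i|) → g y ≤ g x)
    (hf0 : ∀ x, 0 ≤ f x) (hg0 : ∀ x, 0 ≤ g x) {x x' : EuclideanSpace ℝ (Fin n)}
    (h : ∀ i, |x i| ≤ |x' i|) : supConv f g x' ≤ supConv f g x := by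
  refine ciSup_le fun y' => ?_
  -- The coordinatewise contraction taking `x'` to `x` is applied to `x' + y'` and `x' - y'`.
  set θ : Fin n → ℝ := fun i => x i / x' i with hθ
  have hθ1 : ∀ i, |θ i| ≤ 1 := fun i => by
    rw [hθ, abs_div]; exact div_le_one_of_le₀ (h i) (abs_nonneg _)
  have hx : ∀ i, x i = θ i * x' i := fun i => by
    by_cases hi : x' i = 0
    · have := h i
      rw [hi, abs_zero] at this
      rw [hi, mul_zero, abs_nonpos_iff.1 this]
    · exact (div_mul_cancel₀ _ hi).symm
  refine le_trans (Real.sqrt_le_sqrt (mul_le_mul (hf _ _ fun i => ?_) (hg _ _ fun i => ?_)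
    (hg0 _) (hf0 _))) (le_ciSup ⟨_, bddAbove_supConv hf hg hf0 hg0 x⟩
      (WithLp.toLp 2 fun i => θ i * y' i))
  · simp only [PiLp.add_apply]
    rw [hx i, ← mul_add, abs_mul]
    exact mul_le_of_le_one_left (abs_nonneg _) (hθ1 i)
  · simp only [PiLp.sub_apply]
    rw [hx i, ← mul_sub, abs_mul]
    exact mul_le_of_le_one_left (abs_nonneg _) (hθ1 i)

lemma lintegral_toLp (F : EuclideanSpace ℝ (Fin n) → ℝ≥0∞) :
    ∫⁻ x : Fin n → ℝ, F (WithLp.toLp 2 x) = ∫⁻ x, F x :=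
  (PiLp.volume_preserving_toLp (Fin n)).lintegral_comp_emb
    (MeasurableEquiv.toLp 2 (Fin n → ℝ)).measurableEmbedding F

lemma mem_cube_iff {M : ℝ} {x : EuclideanSpace ℝ (Fin n)} : x ∈ cube n M ↔ ∀ i, |x i| ≤ M := by
  simp [cube, abs_le]

lemma measurableSet_cube (n : ℕ) (M : ℝ) : MeasurableSet (cube n M) := by
  have : cube n M = ⋂ i, (fun x : EuclideanSpace ℝ (Fin n) => x i) ⁻¹' Icc (-M) M := by
    ext x; simp [cube]
  rw [this]
  exact MeasurableSet.iInter fun i =>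
    (EuclideanSpace.proj (𝕜 := ℝ) i).continuous.measurable measurableSet_Icc

lemma volume_cube_ne_top (n : ℕ) (M : ℝ) : volume (cube n M) ≠ ∞ := by
  rw [← (PiLp.volume_preserving_toLp (Fin n)).measure_preimage_emb
    (MeasurableEquiv.toLp 2 (Fin n → ℝ)).measurableEmbedding]
  have : (WithLp.toLp 2 ⁻¹' cube n M : Set (Fin n → ℝ))
      = Icc (fun _ => -M) (fun _ => M) := by
    ext x
    simp [cube, Pi.le_def, forall_and]
  rw [this]
  exact isCompact_Icc.measure_lt_top.ne

lemma supConv_eq_zero {M : ℝ} (hf : ∀ x, x ∉ cube n M → f x = 0)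
    (hg : ∀ x, x ∉ cube n M → g x = 0) {x : EuclideanSpace ℝ (Fin n)} (hx : x ∉ cube n M) :
    supConv f g x = 0 := by
  have : ∀ y, √(f (x + y) * g (x - y)) = 0 := fun y => by
    by_cases h1 : x + y ∈ cube n M
    · by_cases h2 : x - y ∈ cube n M
      · exfalso
        rw [mem_cube_iff] at h1 h2 hx
        push Not at hx
        obtain ⟨i, hi⟩ := hx
        have h1 := abs_le.1 (h1 i)
        have h2 := abs_le.1 (h2 i)
        simp only [PiLp.add_apply, PiLp.sub_apply] at h1 h2
        exact not_le.2 hi (abs_le.2 ⟨by linarith [h1.1, h2.1], by linarith [h1.2, h2.2]⟩)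
      · simp [hg _ h2]
    · simp [hf _ h1]
  simp [supConv, this]

/-- The Knothe map, read in Euclidean space, pushes the uniform law to the measure with density
`f`. -/
lemma map_knothe_eq_densityMeasure {M : ℝ} (hf : ∫ x, f x = 1) (hf0 : ∀ x, 0 ≤ f x)
    {F : (Fin n → ℝ) → ℝ≥0∞} (hF : IsBoxDensity M F)
    (hFf : F =ᵐ[volume] fun x => ENNReal.ofReal (f (WithLp.toLp 2 x))) :
    (Measure.pi fun _ => signedUniform).map (fun u => WithLp.toLp 2 (knothe n F u))
      = densityMeasure f := by
  have hmeas : Measurable fun u => WithLp.toLp 2 (knothe n F u) :=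
    (MeasurableEquiv.toLp 2 (Fin n → ℝ)).measurable.comp
      (IsBoxDensity.measurable_knothe hF.measurable)
  have hint : Integrable f := by
    by_contra h
    rw [integral_undef h] at hf
    exact zero_ne_one hf
  have hmass : ∫⁻ x, F x = 1 := by
    rw [lintegral_congr_ae hFf, lintegral_toLp fun x => ENNReal.ofReal (f x),
      ← ofReal_integral_eq_lintegral_ofReal hint (ae_of_all _ hf0), hf, ENNReal.ofReal_one]
  ext s hs
  have hψ : Measurable fun x : Fin n → ℝ =>
      s.indicator (1 : EuclideanSpace ℝ (Fin n) → ℝ≥0∞) (WithLp.toLp 2 x) :=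
    (measurable_one.indicator hs).comp (MeasurableEquiv.toLp 2 (Fin n → ℝ)).measurable
  have h := hF.lintegral_mul_eq hψ
  rw [hmass, one_mul] at h
  rw [densityMeasure, withDensity_apply _ hs, ← lintegral_indicator_one hs,
    lintegral_map (measurable_one.indicator hs) hmeas, ← h, ← lintegral_indicator hs,
    ← lintegral_toLp]
  refine lintegral_congr_ae ?_
  filter_upwards [hFf] with x hx
  rw [hx]
  by_cases hxs : WithLp.toLp 2 x ∈ s <;> simp [hxs]

/-- Two maps with laws `μ` and `ν` on a common measure space give a coupling, whose cost bounds the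
Wasserstein distance. -/
lemma W2_sq_le {μ ν : Measure (EuclideanSpace ℝ (Fin n))} {Ω : Type*} [MeasurableSpace Ω]
    {P : Measure Ω} {Φ Γ : Ω → Fin n → ℝ} (hΦ : Measurable Φ) (hΓ : Measurable Γ)
    (hμ : P.map (fun u => WithLp.toLp 2 (Φ u)) = μ)
    (hν : P.map (fun u => WithLp.toLp 2 (Γ u)) = ν) :
    W2 μ ν ^ 2 ≤ ∫⁻ u, ∑ i, ENNReal.ofReal ((Φ u i - Γ u i) ^ 2) ∂P := by
  have h1 : Measurable fun u => (WithLp.toLp 2 (Φ u) : EuclideanSpace ℝ (Fin n)) :=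
    (MeasurableEquiv.toLp 2 (Fin n → ℝ)).measurable.comp hΦ
  have h2 : Measurable fun u => (WithLp.toLp 2 (Γ u) : EuclideanSpace ℝ (Fin n)) :=
    (MeasurableEquiv.toLp 2 (Fin n → ℝ)).measurable.comp hΓ
  have hc : IsCoupling μ ν (P.map fun u => (WithLp.toLp 2 (Φ u), WithLp.toLp 2 (Γ u))) := by
    constructor
    · rw [Measure.map_map measurable_fst (h1.prodMk h2)]; exact hμ
    · rw [Measure.map_map measurable_snd (h1.prodMk h2)]; exact hν
  have hle : W2 μ ν ≤ _ := iInf₂_le _ hc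
  have hcost : Measurable fun z : EuclideanSpace ℝ (Fin n) × EuclideanSpace ℝ (Fin n) =>
      ‖z.1 - z.2‖ₑ ^ 2 := (measurable_fst.sub measurable_snd).enorm.pow_const 2
  rw [lintegral_map hcost (h1.prodMk h2)] at hle
  have hsum : ∀ u, ‖(WithLp.toLp 2 (Φ u) : EuclideanSpace ℝ (Fin n)) - WithLp.toLp 2 (Γ u)‖ₑ ^ 2
      = ∑ i, ENNReal.ofReal ((Φ u i - Γ u i) ^ 2) := fun u => by
    rw [← ofReal_norm, ← ENNReal.ofReal_pow (norm_nonneg _),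
      EuclideanSpace.real_norm_sq_eq, ENNReal.ofReal_sum_of_nonneg fun _ _ => sq_nonneg _]
    simp
  simp_rw [hsum] at hle
  calc W2 μ ν ^ 2 ≤ ((∫⁻ u, ∑ i, ENNReal.ofReal ((Φ u i - Γ u i) ^ 2) ∂P) ^ (1 / 2 : ℝ)) ^ 2 := by
        gcongr
    _ = _ := by
        rw [← ENNReal.rpow_natCast, ← ENNReal.rpow_mul]
        norm_num

end

theorem theorem6p1 :
    ∃ C : ℝ, 0 < C ∧
      ∀ (n : ℕ) (M : ℝ), 0 < M →
        ∀ f g : EuclideanSpace ℝ (Fin n) → ℝ,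
          IsProbDensityOn (cube n M) f → IsUnconditional f → IsLogConcave f →
          IsProbDensityOn (cube n M) g → IsUnconditional g → IsLogConcave g →
            IntegrableOn (supConv f g) (cube n M) ∧
            W2 (densityMeasure f) (densityMeasure g) ≠ ∞ ∧
            (W2 (densityMeasure f) (densityMeasure g)).toReal ^ 2 ≤
              C * M ^ 2 * ((∫ x in cube n M, supConv f g x) - 1) := by
  refine ⟨32, by norm_num, fun n M hM f g hf hfu hfl hg hgu hgl => ?_⟩
  obtain ⟨hf0, hfs, hf1⟩ := hf
  obtain ⟨hg0, hgs, hg1⟩ := hg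
  have hfa := fun x y => hfl.anti hfu (x := x) (y := y)
  have hga := fun x y => hgl.anti hgu (x := x) (y := y)
  set F : (Fin n → ℝ) → ℝ≥0∞ := fun x => ENNReal.ofReal (f (WithLp.toLp 2 x)) with hF
  set G : (Fin n → ℝ) → ℝ≥0∞ := fun x => ENNReal.ofReal (g (WithLp.toLp 2 x)) with hG
  set H : (Fin n → ℝ) → ℝ≥0∞ := fun x => ENNReal.ofReal (supConv f g (WithLp.toLp 2 x)) with hH
  have hFa : ∀ x y : Fin n → ℝ, (∀ i, |x i| ≤ |y i|) → F y ≤ F x := fun x y h =>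
    ENNReal.ofReal_le_ofReal (hfa _ _ h)
  have hGa : ∀ x y : Fin n → ℝ, (∀ i, |x i| ≤ |y i|) → G y ≤ G x := fun x y h =>
    ENNReal.ofReal_le_ofReal (hga _ _ h)
  have hHa : ∀ x y : Fin n → ℝ, (∀ i, |x i| ≤ |y i|) → H y ≤ H x := fun x y h =>
    ENNReal.ofReal_le_ofReal (supConv_anti hfa hga hf0 hg0 h)
  have mass_one : ∀ {k : EuclideanSpace ℝ (Fin n) → ℝ}, (∀ x, 0 ≤ k x) → ∫ x, k x = 1 →
      ∫⁻ x : Fin n → ℝ, ENNReal.ofReal (k (WithLp.toLp 2 x)) = 1 := by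
    intro k hk0 hk1
    have hint : Integrable k := by
      by_contra h
      rw [integral_undef h] at hk1
      exact zero_ne_one hk1
    rw [lintegral_toLp fun x => ENNReal.ofReal (k x),
      ← ofReal_integral_eq_lintegral_ofReal hint (ae_of_all _ hk0), hk1, ENNReal.ofReal_one]
  have hF1 : ∫⁻ x, F x = 1 := mass_one hf0 hf1
  have hG1 : ∫⁻ x, G x = 1 := mass_one hg0 hg1
  have hsupp : ∀ {k : EuclideanSpace ℝ (Fin n) → ℝ}, (∀ x, x ∉ cube n M → k x = 0) →
      ∀ (x : Fin n → ℝ) i, M < |x i| → ENNReal.ofReal (k (WithLp.toLp 2 x)) = 0 := by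
    intro k hk x i hi
    rw [hk _ fun h => not_le.2 hi (mem_cube_iff.1 h i), ENNReal.ofReal_zero]
  have hFbox : IsBoxDensity M (outerReg F) :=
    isBoxDensity_outerReg hFa (hsupp hfs) (by simp [hF1]) (by simp [hF1])
  have hGbox : IsBoxDensity M (outerReg G) :=
    isBoxDensity_outerReg hGa (hsupp hgs) (by simp [hG1]) (by simp [hG1])
  have hFae : outerReg F =ᵐ[volume] F := outerReg_ae_eq hFa hFbox.mass_ne_top
  have hGae : outerReg G =ᵐ[volume] G := outerReg_ae_eq hGa hGbox.mass_ne_top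
  have hS0 : ∀ x, 0 ≤ supConv f g x := fun x => Real.iSup_nonneg fun _ => Real.sqrt_nonneg _
  have hSle : ∀ x, supConv f g x ≤ √(f 0 * g 0) := fun x =>
    ciSup_le fun y => bddAbove_supConv hfa hga hf0 hg0 x ⟨y, rfl⟩
  have hSs : ∀ x, x ∉ cube n M → supConv f g x = 0 := fun x hx => supConv_eq_zero hfs hgs hx
  have hHcube : ∫⁻ x, H x = ∫⁻ x in cube n M, ENNReal.ofReal (supConv f g x) := by
    rw [hH, lintegral_toLp fun x => ENNReal.ofReal (supConv f g x),
      ← lintegral_indicator (measurableSet_cube n M)]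
    refine lintegral_congr fun x => ?_
    by_cases hx : x ∈ cube n M <;> simp [hx, hSs]
  have hHtop : ∫⁻ x, H x ≠ ∞ := by
    rw [hHcube]
    refine ne_top_of_le_ne_top ?_
      (lintegral_mono fun x => ENNReal.ofReal_le_ofReal (hSle x))
    simp [ENNReal.mul_eq_top, volume_cube_ne_top]
  have hHreg : outerReg H =ᵐ[volume] H :=
    outerReg_ae_eq hHa (ne_top_of_le_ne_top hHtop (lintegral_mono (outerReg_le hHa)))
  have hSm : AEStronglyMeasurable (supConv f g) := by
    refine AEMeasurable.aestronglyMeasurable ?_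
    rw [← (PiLp.volume_preserving_toLp (Fin n)).aemeasurable_comp_iff
      (MeasurableEquiv.toLp 2 (Fin n → ℝ)).measurableEmbedding]
    refine ⟨fun x => (outerReg H x).toReal, measurable_outerReg.ennreal_toReal, ?_⟩
    filter_upwards [hHreg] with x hx
    rw [hx, hH, Function.comp_apply, ENNReal.toReal_ofReal (hS0 _)]
  have hSint : IntegrableOn (supConv f g) (cube n M) :=
    Measure.integrableOn_of_bounded (volume_cube_ne_top n M) hSm
      (ae_of_all _ fun x => by rw [Real.norm_of_nonneg (hS0 x)]; exact hSle x)
  refine ⟨hSint, ?_⟩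
  have hI : ∫⁻ x, H x = ENNReal.ofReal (∫ x in cube n M, supConv f g x) := by
    rw [hHcube, ofReal_integral_eq_lintegral_ofReal hSint (ae_of_all _ hS0)]
  have hFG : ∀ x y, (F x * G y) ^ (1 / 2 : ℝ) ≤ H fun i => (x i + y i) / 2 := by
    intro x y
    rw [hF, hG, hH]
    beta_reduce
    rw [← ENNReal.ofReal_mul (hf0 _), ENNReal.ofReal_rpow_of_nonneg
      (mul_nonneg (hf0 _) (hg0 _)) (by norm_num), ← Real.sqrt_eq_rpow]
    refine ENNReal.ofReal_le_ofReal ?_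
    have h := le_ciSup ⟨_, bddAbove_supConv hfa hga hf0 hg0
      (WithLp.toLp 2 fun i => (x i + y i) / 2)⟩ (WithLp.toLp 2 fun i => (x i - y i) / 2)
    refine le_trans (le_of_eq ?_) h
    congr 3 <;> (congr 1; ext i; simp; ring)
  have hmain := hFbox.transport_le hGbox measurable_outerReg (outerReg_mul_rpow_le hFa hGa hFG)
  set K := ∫⁻ u, ∑ i, ENNReal.ofReal ((knothe n (outerReg F) u i - knothe n (outerReg G) u i) ^ 2)
    ∂Measure.pi fun _ => signedUniform with hK
  rw [lintegral_congr_ae hFae, lintegral_congr_ae hGae, lintegral_congr_ae hHreg, hF1, hG1, hI,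
    mul_one, ENNReal.one_rpow, one_mul] at hmain
  have hW : W2 (densityMeasure f) (densityMeasure g) ^ 2 ≤ K :=
    W2_sq_le (IsBoxDensity.measurable_knothe hFbox.measurable)
      (IsBoxDensity.measurable_knothe hGbox.measurable)
      (map_knothe_eq_densityMeasure hf1 hf0 hFbox hFae)
      (map_knothe_eq_densityMeasure hg1 hg0 hGbox hGae)
  have hκ : 0 < 1 / (32 * M ^ 2) := by positivity
  have hKtop : K ≠ ∞ := by
    intro h
    rw [h, ENNReal.mul_top (by simpa using hκ)] at hmain
    simp at hmain
  refine ⟨fun h => ?_, ?_⟩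
  · rw [h] at hW
    exact hKtop (by simpa using hW)
  have hW' := ENNReal.toReal_mono hKtop hW
  rw [ENNReal.toReal_pow] at hW'
  have hreal : 1 + 1 / (32 * M ^ 2) * K.toReal ≤ ∫ x in cube n M, supConv f g x := by
    rw [← ENNReal.ofReal_toReal hKtop, ← ENNReal.ofReal_mul hκ.le, ← ENNReal.ofReal_one,
      ← ENNReal.ofReal_add zero_le_one (mul_nonneg hκ.le ENNReal.toReal_nonneg)] at hmain
    exact (ENNReal.ofReal_le_ofReal_iff (integral_nonneg hS0)).1 hmain
  calc _ ≤ K.toReal := hW'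
    _ = 32 * M ^ 2 * (1 / (32 * M ^ 2) * K.toReal) := by field_simp
    _ ≤ _ := by gcongr; linarith
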